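/- All manifolds and maps are of class $C^\infty$. Let $n>m\ge 1$, let $N$ be a compact connected $n$-dimensional manifold with boundary, and let $F\colon N\to\mathbb{R}^m$ be a boundary special generic map, i.e. a smooth map whose differential $dF_p\colon T_pN\to\mathbb{R}^m$ is surjective at every $p\in N$ (boundary points included) and such that every singular point of $F|_{\partial N}$ is a boundary definite fold point of $F$. Here the singular set $S(F|_{\partial N})$ is the set of $p\in\partial N$ at which $d(F|_{\partial N})_p\colon T_p\partial N\to\mathbb{R}^m$ is not surjective, and $p\in\partial N$ is a boundary definite fold point of $F$ if there are smooth local coordinates $(x_1,\dots,x_n)$ of $N$ centred at $p$, with $x_n>0$ and $x_n=0$ corresponding to $\operatorname{Int}N$ and $\partial N$, and smooth local coordinates $(y_1,\dots,y_m)$ of $\mathbb{R}^m$ around $F(p)$ in which $F$ has the form $$(x_1,\dots,x_n)\mapsto\Bigl(x_1,\dots,x_{m-1},\ \sum_{i=m}^{n-1}x_i^2+x_n\Bigr).$$ Let $W_F=N/{\sim}$ be the Reeb space of $F$ with the quotient topology, where $x\sim y$ if $F(x)=F(y)$ and $x,y$ lie in the same connected component of $F^{-1}(F(x))$; let $q_F\colon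 N\to W_F$ be the quotient map and $\overline F\colon W_F\to\mathbb{R}^m$ the Reeb map, the unique map with $F=\overline F\circ q_F$. Then $W_F$ is Hausdorff and second countable and carries the structure of a smooth $m$-dimensional manifold with boundary such that $\overline F$ is a smooth immersion, $q_F$ is smooth, $S(F|_{\partial N})$ is a smooth $(m-1)$-dimensional embedded submanifold of $\partial N$, and $q_F$ restricts to a diffeomorphism $S(F|_{\partial N})\to\partial W_F$. -/

import Mathlib

open scoped Manifold ContDiff

noncomputable section

/-! ### The boundary of a smooth manifold with boundary, as a smooth manifold -/

section Boundary

/-- The inclusion `v ↦ (0, v)` of `ℝ^k` as the boundary hyperplane of the half-space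
`{x ∈ ℝ^(k+1) | 0 ≤ x 0}`. -/
def boundaryIncl (k : ℕ) (v : EuclideanSpace ℝ (Fin k)) : EuclideanHalfSpace (k + 1) :=
  ⟨WithLp.toLp 2 (Fin.cons 0 v), le_of_eq rfl⟩

/-- The projection `(t, v) ↦ v` of `ℝ^(k+1)` to `ℝ^k`. -/
def boundaryProj (k : ℕ) (x : EuclideanSpace ℝ (Fin (k + 1))) : EuclideanSpace ℝ (Fin k) :=
  WithLp.toLp 2 (fun i => x i.succ)

theorem contDiff_boundaryIncl (k : ℕ) :
    ContDiff ℝ ∞ (fun v => (boundaryIncl k v).1) := by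
  rw [contDiff_euclidean]
  intro i
  refine Fin.cases ?_ (fun j => ?_) i
  · exact contDiff_const
  · exact contDiff_euclidean.1 contDiff_id j

theorem contDiff_boundaryProj (k : ℕ) : ContDiff ℝ ∞ (boundaryProj k) := by
  rw [contDiff_euclidean]
  intro i
  exact contDiff_euclidean.1 contDiff_id i.succ

theorem continuous_boundaryIncl (k : ℕ) : Continuous (boundaryIncl k) :=
  Continuous.subtype_mk (contDiff_boundaryIncl k).continuous _

theorem boundaryProj_boundaryIncl (k : ℕ) (v : EuclideanSpace ℝ (Fin k)) :
    boundaryProj k (boundaryIncl k v).1 = v := rfl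

theorem boundaryIncl_boundaryProj (k : ℕ) (x : EuclideanHalfSpace (k + 1)) (hx : x.1 0 = 0) :
    boundaryIncl k (boundaryProj k x.1) = x := by
  apply EuclideanHalfSpace.ext
  ext i
  refine Fin.cases ?_ (fun j => ?_) i
  · exact hx.symm
  · rfl

variable {k : ℕ} {M : Type*} [TopologicalSpace M] [ChartedSpace (EuclideanHalfSpace (k + 1)) M]

/-- A chart of the maximal atlas detects the boundary as the locus where coordinate `0` vanishes. -/
theorem mem_boundary_iff_of_mem_maximalAtlas
    [IsManifold (𝓡∂ (k + 1)) ∞ M] {e : OpenPartialHomeomorph M (EuclideanHalfSpace (k + 1))}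
    (he : e ∈ IsManifold.maximalAtlas (𝓡∂ (k + 1)) ∞ M) {x : M} (hx : x ∈ e.source) :
    x ∈ (𝓡∂ (k + 1)).boundary M ↔ (e x).1 0 = 0 := by
  let Φ : PartialDiffeomorph (𝓡∂ (k + 1)) (𝓡∂ (k + 1)) M (EuclideanHalfSpace (k + 1)) ∞ :=
    { toPartialEquiv := e.toPartialEquiv
      open_source := e.open_source
      open_target := e.open_target
      contMDiffOn_toFun := contMDiffOn_of_mem_maximalAtlas he
      contMDiffOn_invFun := contMDiffOn_symm_of_mem_maximalAtlas he }
  have h : IsLocalDiffeomorphAt (𝓡∂ (k + 1)) (𝓡∂ (k + 1)) ∞ e x := ⟨Φ, hx, fun _ _ => rfl⟩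
  have h1 := h.isBoundaryPoint_iff (by simp)
  change (𝓡∂ (k + 1)).IsBoundaryPoint x ↔ _
  rw [h1, ModelWithCorners.isBoundaryPoint_iff, frontier_range_modelWithCornersEuclideanHalfSpace]
  rw [extChartAt_self_apply]
  exact eq_comm

/-- The chart of the boundary `∂M` induced by a chart `e` of `M`: it sends `x ∈ ∂M` to the
coordinates of `e x` other than coordinate `0`. The point `p` only serves as a value of the inverse
outside the target. -/
def boundaryChart [IsManifold (𝓡∂ (k + 1)) ∞ M]
    (e : OpenPartialHomeomorph M (EuclideanHalfSpace (k + 1)))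
    (he : e ∈ IsManifold.maximalAtlas (𝓡∂ (k + 1)) ∞ M) (p : (𝓡∂ (k + 1)).boundary M) :
    OpenPartialHomeomorph ((𝓡∂ (k + 1)).boundary M) (EuclideanSpace ℝ (Fin k)) where
  toFun x := boundaryProj k (e x.1).1
  invFun v := by
    classical
    exact if h : boundaryIncl k v ∈ e.target then
      ⟨e.symm (boundaryIncl k v), (mem_boundary_iff_of_mem_maximalAtlas he (e.map_target h)).2 (by
        rw [e.right_inv h]; rfl)⟩
    else p
  source := {x | x.1 ∈ e.source}
  target := {v | boundaryIncl k v ∈ e.target}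
  map_source' x hx := by
    have h0 := (mem_boundary_iff_of_mem_maximalAtlas he hx).1 x.2
    change boundaryIncl k (boundaryProj k (e x.1).1) ∈ e.target
    rw [boundaryIncl_boundaryProj k _ h0]
    exact e.map_source hx
  map_target' v hv := by
    have hv' : boundaryIncl k v ∈ e.target := hv
    simp only [hv', dif_pos]
    exact e.map_target hv'
  left_inv' x hx := by
    have h0 := (mem_boundary_iff_of_mem_maximalAtlas he hx).1 x.2
    have hx' : x.1 ∈ e.source := hx
    have h1 := boundaryIncl_boundaryProj k _ h0
    have h2 : boundaryIncl k (boundaryProj k (e x.1).1) ∈ e.target := by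
      rw [h1]; exact e.map_source hx'
    rw [dif_pos h2]
    apply Subtype.ext
    change e.symm (boundaryIncl k (boundaryProj k (e x.1).1)) = x.1
    rw [h1, e.left_inv hx']
  right_inv' v hv := by
    have hv' : boundaryIncl k v ∈ e.target := hv
    rw [dif_pos hv']
    change boundaryProj k (e (e.symm (boundaryIncl k v))).1 = v
    rw [e.right_inv hv', boundaryProj_boundaryIncl]
  open_source := e.open_source.preimage continuous_subtype_val
  open_target := e.open_target.preimage (continuous_boundaryIncl k)
  continuousOn_toFun := by
    refine (contDiff_boundaryProj k).continuous.comp_continuousOn ?_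
    refine continuous_subtype_val.comp_continuousOn ?_
    exact e.continuousOn.comp continuous_subtype_val.continuousOn (fun x hx => hx)
  continuousOn_invFun := by
    rw [Topology.IsInducing.subtypeVal.continuousOn_iff]
    have h : ContinuousOn (fun v => e.symm (boundaryIncl k v))
        {v | boundaryIncl k v ∈ e.target} :=
      e.continuousOn_symm.comp (continuous_boundaryIncl k).continuousOn (fun v hv => hv)
    refine h.congr (fun v hv => ?_)
    have hv' : boundaryIncl k v ∈ e.target := hv
    simp only [Function.comp_apply, hv', dif_pos]

/-- The boundary of a smooth `(k+1)`-manifold with boundary is charted on `ℝ^k`, by the charts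
induced by all charts of the smooth structure of `M`. -/
instance boundaryChartedSpace [IsManifold (𝓡∂ (k + 1)) ∞ M] :
    ChartedSpace (EuclideanSpace ℝ (Fin k)) ((𝓡∂ (k + 1)).boundary M) where
  atlas := {c | ∃ e, ∃ he : e ∈ IsManifold.maximalAtlas (𝓡∂ (k + 1)) ∞ M, ∃ p,
    c = boundaryChart e he p}
  chartAt p := boundaryChart (chartAt (EuclideanHalfSpace (k + 1)) p.1)
    (IsManifold.chart_mem_maximalAtlas p.1) p
  mem_chart_source p := mem_chart_source (EuclideanHalfSpace (k + 1)) p.1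
  chart_mem_atlas p := ⟨_, IsManifold.chart_mem_maximalAtlas p.1, p, rfl⟩

instance boundaryIsManifold [IsManifold (𝓡∂ (k + 1)) ∞ M] :
    IsManifold (𝓡 k) ∞ ((𝓡∂ (k + 1)).boundary M) := by
  apply isManifold_of_contDiffOn
  rintro c c' ⟨e, he, p, rfl⟩ ⟨e', he', p', rfl⟩
  have h := (contDiffGroupoid ∞ (𝓡∂ (k + 1))).compatible_of_mem_maximalAtlas he he'
  rw [contDiffGroupoid, mem_groupoid_of_pregroupoid] at h
  have h1 := h.1
  change ContDiffOn ℝ ∞ _ _ at h1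
  have key : ∀ v, boundaryIncl k v ∈ e.target →
      ((boundaryChart e he p).symm v).1 = e.symm (boundaryIncl k v) := by
    intro v hv
    exact congrArg Subtype.val (dif_pos hv)
  have h2 := (contDiff_boundaryProj k).comp_contDiffOn (h1.comp
    (contDiff_boundaryIncl k).contDiffOn
    (s := {v | boundaryIncl k v ∈ e.target ∧ e.symm (boundaryIncl k v) ∈ e'.source}) ?_)
  · refine h2.congr_mono ?_ ?_
    · rintro v ⟨⟨hv, -⟩, -⟩
      have hv' : boundaryIncl k v ∈ e.target := hv
      change boundaryProj k (e' ((boundaryChart e he p).symm v).1).1 = _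
      rw [key v hv']
      have : (𝓡∂ (k + 1)).symm (boundaryIncl k v).1 = boundaryIncl k v :=
        (𝓡∂ (k + 1)).left_inv (boundaryIncl k v)
      simp [this]
    · rintro v ⟨⟨hv, hv2⟩, -⟩
      have hv' : boundaryIncl k v ∈ e.target := hv
      have hv2' : ((boundaryChart e he p).symm v).1 ∈ e'.source := hv2
      rw [key v hv'] at hv2'
      exact ⟨hv', hv2'⟩
  · rintro v ⟨hv, hv2⟩
    have : (𝓡∂ (k + 1)).symm (boundaryIncl k v).1 = boundaryIncl k v :=
      (𝓡∂ (k + 1)).left_inv (boundaryIncl k v)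
    refine ⟨?_, ⟨boundaryIncl k v, rfl⟩⟩
    simp [this, hv, hv2]

end Boundary

/-! ### Reeb spaces -/

section Reeb

/-- `x ∼ y` if `F x = F y` and `x`, `y` lie in the same connected component of `F⁻¹(F x)`. -/
def reebSetoid {X Y : Type*} [TopologicalSpace X] (F : X → Y) : Setoid X where
  r x y := F x = F y ∧ y ∈ connectedComponentIn (F ⁻¹' {F x}) x
  iseqv :=
    { refl := fun _ => ⟨rfl, mem_connectedComponentIn rfl⟩
      symm := by
        rintro x y ⟨h, hy⟩
        refine ⟨h.symm, ?_⟩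
        rw [← h, ← connectedComponentIn_eq hy]
        exact mem_connectedComponentIn rfl
      trans := by
        rintro x y z ⟨h, hy⟩ ⟨h', hz⟩
        refine ⟨h.trans h', ?_⟩
        rw [connectedComponentIn_eq hy, h]
        exact hz }

/-- The Reeb space `W_F`, with the quotient topology. -/
abbrev ReebSpace {X Y : Type*} [TopologicalSpace X] (F : X → Y) : Type _ :=
  Quotient (reebSetoid F)

/-- The quotient map `q_F : X → W_F`. -/
def reebQuot {X Y : Type*} [TopologicalSpace X] (F : X → Y) : X → ReebSpace F :=
  Quotient.mk (reebSetoid F)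

/-- The Reeb map `W_F → Y`, through which `F` factors. -/
def reebMap {X Y : Type*} [TopologicalSpace X] (F : X → Y) : ReebSpace F → Y :=
  Quotient.lift F (fun _ _ h => h.1)

end Reeb

/-! ### Boundary special generic maps -/

section SpecialGeneric

/-- The boundary definite fold normal form from the half-space in `ℝ^(n+1)` to `ℝ^(m+1)`:
`(x_0, …, x_n) ↦ (∑_{i=m+1}^{n} x_i ^ 2 + x_0, x_1, …, x_m)`. Coordinate `0` of the source is the one
that vanishes on the boundary, and coordinate `0` of the target is the folded one. -/
def boundaryFoldForm (n m : ℕ) (h : m < n) (x : EuclideanSpace ℝ (Fin (n + 1))) :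
    EuclideanSpace ℝ (Fin (m + 1)) :=
  WithLp.toLp 2 (Fin.cons ((∑ i ∈ Finset.univ.filter (fun i : Fin (n + 1) => m < i.val), x i ^ 2) + x 0)
    (fun j : Fin m => x (Fin.castLE h.le j).succ))

variable {n m : ℕ} {N : Type*} [TopologicalSpace N] [ChartedSpace (EuclideanHalfSpace (n + 1)) N]

/-- `p` is a boundary definite fold point of `F`: in smooth charts of `N` centred at `p` and of
`ℝ^(m+1)` around `F p`, the map `F` is the normal form. As the charts of `N` take values in the
half-space, the centre `p` is a boundary point. -/
def IsBoundaryDefiniteFoldPoint (h : m < n) (F : N → EuclideanSpace ℝ (Fin (m + 1))) (p : N) :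
    Prop :=
  ∃ φ ∈ IsManifold.maximalAtlas (𝓡∂ (n + 1)) ∞ N,
  ∃ ψ ∈ IsManifold.maximalAtlas (𝓡 (m + 1)) ∞ (EuclideanSpace ℝ (Fin (m + 1))),
    p ∈ φ.source ∧ φ p = 0 ∧ Set.MapsTo F φ.source ψ.source ∧
    ∀ x ∈ φ.source, ψ (F x) = boundaryFoldForm n m h (φ x).1

/-- The singular set `S(F|∂N)`: the points of `∂N` at which the differential of the restriction
of `F` to the manifold `∂N` is not surjective. -/
def boundarySingularSet (n : ℕ) {m : ℕ} {N : Type*} [TopologicalSpace N]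
    [ChartedSpace (EuclideanHalfSpace (n + 1)) N] [IsManifold (𝓡∂ (n + 1)) ∞ N]
    (F : N → EuclideanSpace ℝ (Fin (m + 1))) : Set ((𝓡∂ (n + 1)).boundary N) :=
  {p | ¬ Function.Surjective
    (mfderiv (𝓡 n) (𝓡 (m + 1)) (fun x : (𝓡∂ (n + 1)).boundary N => F x.1) p)}

/-- `F : N → ℝ^(m+1)`, with `dim N = n + 1 > m + 1`, is a boundary special generic map: a smooth map
with surjective differential everywhere such that all singular points of `F|∂N` are boundary
definite fold points of `F`. -/
structure IsBoundarySpecialGeneric [IsManifold (𝓡∂ (n + 1)) ∞ N] (h : m < n)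
    (F : N → EuclideanSpace ℝ (Fin (m + 1))) : Prop where
  contMDiff : ContMDiff (𝓡∂ (n + 1)) (𝓡 (m + 1)) ∞ F
  submersion : ∀ p, Function.Surjective (mfderiv (𝓡∂ (n + 1)) (𝓡 (m + 1)) F p)
  fold : ∀ p ∈ boundarySingularSet n F, IsBoundaryDefiniteFoldPoint h F p.1

end SpecialGeneric

end

/-! All structure on the Reeb space is pulled back along the Reeb map: a chart is the Reeb map
followed by a chart `ψ` of the target, with values in a half-space (`HalfSpaceChartData`).
Transition maps are then restrictions of target transition maps, the Reeb map is the inclusion of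
the half-space in charts, and the quotient map is smooth because it is continuous and its composite
with this immersion is `F`. What has to be shown is that, near each point of the Reeb space, the
Reeb map is injective and open into a half-space.

Compactness reduces this to a study of `F` along one fibre component, since components have
arbitrarily small saturated open neighbourhoods (`exists_isOpen_isReebSaturated`); these also give
the Hausdorff property. There are two kinds of component.

If a component avoids the singular set of the restriction to the boundary, then `F` is open with
locally connected fibres near each of its points. This is the implicit function theorem, applied at
boundary points to an extension of `F` by reflection. Connectedness of the component spreads the
local statement along it (`exists_isOpen_reebQuot_eq_of_isOpenAt`), and an interior chart results.

If a component contains a fold point, it is that single point, because the normal form vanishes on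
the half-space only at the origin. Nearby fibres are graphs over convex sets, and the normal form is
open as a map between half-spaces (`nhds_le_map_halfSpaceFold`), so a boundary chart results.

In a fold chart the singular set is a coordinate plane of the boundary of `N`, and the normal form
copies the coordinates on this plane to the boundary of the target half-space. This gives the slice
charts of the singular set, and in them the diffeomorphism is the identity. -/

noncomputable section

/-! ### Topology of Reeb spaces -/

section ReebTopology

open Set Filter Topology

variable {X Y : Type*} [TopologicalSpace X] {f : X → Y}

/-- The connected component of the fibre of `f` through `x`. -/
def fibreComponent (f : X → Y) (x : X) : Set X := connectedComponentIn (f ⁻¹' {f x}) x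

theorem mem_fibreComponent_self (f : X → Y) (x : X) : x ∈ fibreComponent f x :=
  mem_connectedComponentIn rfl

theorem eq_of_mem_fibreComponent {x y : X} (h : y ∈ fibreComponent f x) : f y = f x :=
  connectedComponentIn_subset (f ⁻¹' {f x}) x h

theorem reebQuot_eq_iff {x y : X} : reebQuot f x = reebQuot f y ↔ y ∈ fibreComponent f x := by
  refine ⟨fun h => (Quotient.exact h : (reebSetoid f).r x y).2, fun h => ?_⟩
  exact Quotient.sound (s := reebSetoid f) ⟨(eq_of_mem_fibreComponent h).symm, h⟩

theorem reebMap_reebQuot (x : X) : reebMap f (reebQuot f x) = f x := rfl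

theorem reebQuot_surjective (f : X → Y) : Function.Surjective (reebQuot f) :=
  Quotient.mk_surjective

theorem continuous_reebQuot (f : X → Y) : Continuous (reebQuot f) := continuous_quot_mk

theorem mem_fibreComponent_of_isPreconnected {P : Set X} (hP : IsPreconnected P) {x y : X}
    (hx : x ∈ P) (hy : y ∈ P) (hPf : ∀ z ∈ P, f z = f x) : y ∈ fibreComponent f x :=
  hP.subset_connectedComponentIn hx hPf hy

/-- A set is saturated for the Reeb relation if it contains the fibre components of its points. -/
def IsReebSaturated (f : X → Y) (V : Set X) : Prop := ∀ z ∈ V, fibreComponent f z ⊆ V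

theorem IsReebSaturated.preimage_image {V : Set X} (hV : IsReebSaturated f V) :
    reebQuot f ⁻¹' (reebQuot f '' V) = V := by
  refine Subset.antisymm ?_ (subset_preimage_image _ _)
  rintro x ⟨z, hz, hzx⟩
  exact hV z hz (reebQuot_eq_iff.1 hzx)

theorem IsReebSaturated.isOpen_image {V : Set X} (hV : IsReebSaturated f V) (ho : IsOpen V) :
    IsOpen (reebQuot f '' V) := by
  have h : IsOpen (reebQuot f ⁻¹' (reebQuot f '' V)) := by rwa [hV.preimage_image]
  exact h

variable [TopologicalSpace Y]

theorem continuous_reebMap (hf : Continuous f) : Continuous (reebMap f) := hf.quotient_lift _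

/-- The closure of the component is still connected and still inside the closed fibre, so by
maximality the component is closed. -/
theorem isCompact_fibreComponent [CompactSpace X] [T1Space Y] (hf : Continuous f) (x : X) :
    IsCompact (fibreComponent f x) := by
  have hK : IsClosed (f ⁻¹' {f x}) := isClosed_singleton.preimage hf
  refine IsClosed.isCompact (isClosed_of_closure_subset ?_)
  exact isPreconnected_connectedComponentIn.closure.subset_connectedComponentIn
    (subset_closure (mem_fibreComponent_self f x))
    (closure_minimal (connectedComponentIn_subset _ _) hK)

/-- Fibre components of a map from a compact Hausdorff space have a basis of saturated open
neighbourhoods. -/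
theorem exists_isOpen_isReebSaturated [CompactSpace X] [T2Space X] [T2Space Y] (hf : Continuous f)
    (x : X) {A : Set X} (hA : IsOpen A) (hxA : fibreComponent f x ⊆ A) :
    ∃ V, IsOpen V ∧ x ∈ V ∧ V ⊆ A ∧ IsReebSaturated f V := by
  set K : Set X := f ⁻¹' {f x}
  have hKc : IsClosed K := isClosed_singleton.preimage hf
  have hK : IsCompact K := hKc.isCompact
  have : CompactSpace K := isCompact_iff_compactSpace.1 hK
  have hxK : x ∈ K := rfl
  -- In the compact Hausdorff fibre `K`, the component of `x` is the intersection of the clopen sets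
  -- containing `x`; by compactness one of these already lies in `A`.
  obtain ⟨D, hD, hxD, hDA⟩ : ∃ D : Set K, IsClopen D ∧ (⟨x, hxK⟩ : K) ∈ D ∧
      D ⊆ Subtype.val ⁻¹' A := by
    have hne : Nonempty {s : Set K // IsClopen s ∧ (⟨x, hxK⟩ : K) ∈ s} :=
      ⟨⟨univ, isClopen_univ, mem_univ _⟩⟩
    have hdir : Directed (· ⊇ ·)
        (fun s : {s : Set K // IsClopen s ∧ (⟨x, hxK⟩ : K) ∈ s} => (s : Set K)) := fun s t =>
      ⟨⟨s ∩ t, s.2.1.inter t.2.1, s.2.2, t.2.2⟩, inter_subset_left, inter_subset_right⟩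
    obtain ⟨D, hD⟩ := exists_subset_nhds_of_isCompact hdir (fun s => s.2.1.1.isCompact)
      (U := Subtype.val ⁻¹' A) (by
        intro z hz
        rw [← connectedComponent_eq_iInter_isClopen] at hz
        refine (hA.preimage continuous_subtype_val).mem_nhds (hxA ?_)
        unfold fibreComponent
        rw [connectedComponentIn_eq_image hxK]
        exact ⟨z, hz, rfl⟩)
    exact ⟨D, D.2.1, D.2.2, hD⟩
  have hD1 : IsCompact (Subtype.val '' D) := hD.1.isCompact.image continuous_subtype_val
  have hD2 : IsCompact (Subtype.val '' Dᶜ) :=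
    hD.compl.1.isCompact.image continuous_subtype_val
  have hdis : Disjoint (Subtype.val '' D : Set X) (Subtype.val '' Dᶜ) :=
    (disjoint_image_iff Subtype.val_injective).2 disjoint_compl_right
  obtain ⟨A₁, A₂, hA₁, hA₂, hDA₁, hDA₂, hA₁₂⟩ := SeparatedNhds.of_isCompact_isCompact hD1 hD2 hdis
  -- The points of `Y` whose whole fibre lies in `(A₁ ∩ A) ∪ A₂`; they form an open set because `f`
  -- is a closed map.
  set U : Set Y := (f '' ((A₁ ∩ A) ∪ A₂)ᶜ)ᶜ
  have hU : IsOpen U :=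
    (hf.isClosedMap _ ((hA₁.inter hA).union hA₂).isClosed_compl).isOpen_compl
  have hUsub : f ⁻¹' U ⊆ (A₁ ∩ A) ∪ A₂ := by
    intro z hz
    by_contra h
    exact hz ⟨z, h, rfl⟩
  have hxU : f x ∈ U := by
    rintro ⟨z, hz, hzx⟩
    apply hz
    by_cases hzD : (⟨z, hzx⟩ : K) ∈ D
    · exact Or.inl ⟨hDA₁ ⟨_, hzD, rfl⟩, hDA hzD⟩
    · exact Or.inr (hDA₂ ⟨_, hzD, rfl⟩)
  refine ⟨(A₁ ∩ A) ∩ f ⁻¹' U, (hA₁.inter hA).inter (hU.preimage hf),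
    ⟨⟨hDA₁ ⟨_, hxD, rfl⟩, hDA hxD⟩, hxU⟩, fun z hz => hz.1.2, ?_⟩
  rintro z ⟨hzA, hzU⟩
  have hsub : fibreComponent f z ⊆ f ⁻¹' U := by
    intro y hy
    change f y ∈ U
    rw [eq_of_mem_fibreComponent hy]
    exact hzU
  refine subset_inter ?_ hsub
  refine isPreconnected_connectedComponentIn.subset_left_of_subset_union (hA₁.inter hA) hA₂
    (hA₁₂.mono_left inter_subset_left) (hsub.trans hUsub) ⟨z, mem_fibreComponent_self f z, hzA⟩

/-- Distinct points are disjoint compact fibre components; these are separated in `X`, and the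
separating open sets are shrunk to saturated ones. -/
theorem t2Space_reebSpace [CompactSpace X] [T2Space X] [T2Space Y] (hf : Continuous f) :
    T2Space (ReebSpace f) := by
  refine ⟨fun w w' hne => ?_⟩
  obtain ⟨x, rfl⟩ := reebQuot_surjective f w
  obtain ⟨y, rfl⟩ := reebQuot_surjective f w'
  have hdis : Disjoint (fibreComponent f x) (fibreComponent f y) := by
    rw [Set.disjoint_left]
    intro z hx hy
    exact hne ((reebQuot_eq_iff.2 hx).trans (reebQuot_eq_iff.2 hy).symm)
  obtain ⟨A, B, hA, hB, hxA, hyB, hAB⟩ := SeparatedNhds.of_isCompact_isCompact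
    (isCompact_fibreComponent hf x) (isCompact_fibreComponent hf y) hdis
  obtain ⟨V, hV, hxV, hVA, hVs⟩ := exists_isOpen_isReebSaturated hf x hA hxA
  obtain ⟨V', hV', hyV, hVB, hVs'⟩ := exists_isOpen_isReebSaturated hf y hB hyB
  refine ⟨_, _, hVs.isOpen_image hV, hVs'.isOpen_image hV', ⟨x, hxV, rfl⟩, ⟨y, hyV, rfl⟩, ?_⟩
  rw [Set.disjoint_left]
  rintro _ ⟨z, hz, rfl⟩ ⟨z', hz', h⟩
  exact Set.disjoint_left.1 hAB (hVA hz) (hVB (hVs' z' hz' (reebQuot_eq_iff.1 h)))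

/-- Nearby points in the same fibre lie in the same component of that fibre. -/
def LocallyFibreConnectedAt (f : X → Y) (x : X) : Prop :=
  ∃ O ∈ 𝓝 x, ∀ z ∈ O, ∀ z' ∈ O, f z = f z' → reebQuot f z = reebQuot f z'

/-- If a fibre component consists of points where `f` is open and locally fibre connected, then
the Reeb map is injective near it. -/
theorem exists_isOpen_reebQuot_eq_of_isOpenAt [CompactSpace X] [T2Space X] [T2Space Y]
    (hf : Continuous f) (x : X) (hl : ∀ z ∈ fibreComponent f x, LocallyFibreConnectedAt f z)
    (ho : ∀ z ∈ fibreComponent f x, 𝓝 (f z) ≤ map f (𝓝 z)) :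
    ∃ A, IsOpen A ∧ fibreComponent f x ⊆ A ∧
      ∀ z ∈ A, ∀ z' ∈ A, f z = f z' → reebQuot f z = reebQuot f z' := by
  -- `P` is symmetric, transitive along the component, and holds between nearby points, so
  -- preconnectedness spreads it to all pairs in the component.
  let P : X → X → Prop := fun a b => ∃ O ∈ 𝓝 a, ∃ O' ∈ 𝓝 b,
    ∀ z ∈ O, ∀ z' ∈ O', f z = f z' → reebQuot f z = reebQuot f z'
  have hP : ∀ a ∈ fibreComponent f x, ∀ b ∈ fibreComponent f x, P a b := by
    intro a ha b hb
    refine (isPreconnected_connectedComponentIn :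
      IsPreconnected (fibreComponent f x)).induction₂ P ?_ ?_ ?_ ha hb
    · intro z hz
      obtain ⟨O, hO, h⟩ := hl z hz
      refine mem_nhdsWithin_of_mem_nhds ?_
      filter_upwards [eventually_mem_nhds_iff.2 hO] with z' hz'
      exact ⟨O, hO, O, hz', h⟩
    · rintro a b c ha hb hc ⟨O, hO, O', hO', h⟩ ⟨Q', hQ', Q, hQ, h'⟩
      -- Openness of `f` at the middle point: every value near `f a = f b` is attained in `O' ∩ Q'`,
      -- at a point through which `z` and `z'` can be compared.
      have hb' : f '' (O' ∩ Q') ∈ 𝓝 (f a) := by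
        rw [eq_of_mem_fibreComponent ha, ← eq_of_mem_fibreComponent hb]
        exact ho b hb (image_mem_map (inter_mem hO' hQ'))
      refine ⟨O ∩ f ⁻¹' (f '' (O' ∩ Q')), inter_mem hO (hf.continuousAt hb'), Q, hQ, ?_⟩
      rintro z ⟨hz, y, ⟨hy, hy'⟩, hyz⟩ z' hz' hzz'
      exact (h z hz y hy hyz.symm).trans (h' y hy' z' hz' (hyz.trans hzz'))
    · rintro a b - - ⟨O, hO, O', hO', h⟩
      exact ⟨O', hO', O, hO, fun z hz z' hz' e => (h z' hz' z hz e.symm).symm⟩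
  have hc := isCompact_fibreComponent hf x
  -- `P` holds around each pair of points of the compact component; the tube lemma makes the
  -- neighbourhood uniform.
  obtain ⟨u, v, hu, hv, hxu, hxv, huv⟩ := generalized_tube_lemma hc hc
    (n := interior {p : X × X | f p.1 = f p.2 → reebQuot f p.1 = reebQuot f p.2})
    isOpen_interior (by
      rintro ⟨a, b⟩ ⟨ha, hb⟩
      obtain ⟨O, hO, O', hO', h⟩ := hP a ha b hb
      rw [mem_interior_iff_mem_nhds]
      filter_upwards [prod_mem_nhds hO hO'] with p hp
      exact h p.1 hp.1 p.2 hp.2)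
  exact ⟨u ∩ v, hu.inter hv, subset_inter hxu hxv,
    fun z hz z' hz' => interior_subset (huv (mk_mem_prod hz.1 hz'.2))⟩

end ReebTopology

/-! ### Local fibre connectedness of submersions on half-spaces -/

section LocalSubmersion

open Set Filter Topology

/-- Arbitrarily small neighbourhoods of `x` meet each fibre of `g` in a set whose points are joined
by a small preconnected subset of the fibre. -/
def IsFibrewiseConnectedAt {X Y : Type*} [TopologicalSpace X] (g : X → Y) (x : X) : Prop :=
  ∀ U ∈ 𝓝 x, ∃ O ∈ 𝓝 x, ∀ z ∈ O, ∀ z' ∈ O, g z = g z' →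
    ∃ P, IsPreconnected P ∧ P ⊆ U ∧ z ∈ P ∧ z' ∈ P ∧ ∀ y ∈ P, g y = g z

/-- Local fibre connectedness may be checked in a chart. -/
theorem locallyFibreConnectedAt_of_chart {X X' Y : Type*} [TopologicalSpace X]
    [TopologicalSpace X'] {f : X → Y} (e : OpenPartialHomeomorph X X') {x : X} (hx : x ∈ e.source)
    (h : IsFibrewiseConnectedAt (f ∘ e.symm) (e x)) : LocallyFibreConnectedAt f x := by
  obtain ⟨O, hO, hOP⟩ := h e.target (e.open_target.mem_nhds (e.map_source hx))
  refine ⟨e.source ∩ e ⁻¹' O, inter_mem (e.open_source.mem_nhds hx)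
    (e.continuousAt hx hO), ?_⟩
  rintro z ⟨hz, hzO⟩ z' ⟨hz', hzO'⟩ hzz'
  obtain ⟨P, hP, hPU, hzP, hzP', hPf⟩ := hOP (e z) hzO (e z') hzO' (by
    simpa [e.left_inv hz, e.left_inv hz'] using hzz')
  rw [reebQuot_eq_iff]
  refine mem_fibreComponent_of_isPreconnected (hP.image _ (e.continuousOn_symm.mono hPU))
    ⟨e z, hzP, e.left_inv hz⟩ ⟨e z', hzP', e.left_inv hz'⟩ ?_
  rintro _ ⟨y, hy, rfl⟩
  simpa [e.left_inv hz] using hPf y hy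

/-- Openness at nearby points may be checked in a chart. -/
theorem eventually_nhds_le_map_of_chart {X X' Y : Type*} [TopologicalSpace X]
    [TopologicalSpace X'] [TopologicalSpace Y] {f : X → Y} (e : OpenPartialHomeomorph X X') {x : X}
    (hx : x ∈ e.source)
    (h : ∀ᶠ z in 𝓝 (e x), 𝓝 ((f ∘ e.symm) z) ≤ map (f ∘ e.symm) (𝓝 z)) :
    ∀ᶠ z in 𝓝 x, 𝓝 (f z) ≤ map f (𝓝 z) := by
  filter_upwards [e.open_source.mem_nhds hx, e.continuousAt hx h] with z hz hle
  have hle' : 𝓝 ((f ∘ e.symm) (e z)) ≤ map (f ∘ e.symm) (𝓝 (e z)) := hle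
  rw [← map_map, e.symm_map_nhds_eq hz] at hle'
  simpa [e.left_inv hz] using hle'

/-! ### Submersions and the implicit function theorem -/

section Strict

variable {E Z F : Type*} [NormedAddCommGroup E] [NormedSpace ℝ E] [CompleteSpace E]
  [NormedAddCommGroup Z] [NormedSpace ℝ Z] [FiniteDimensional ℝ Z]

/-- The implicit function theorem gives a chart in which `G` is the first projection, so `G` is open
at every point of the chart's source. -/
theorem HasStrictFDerivAt.eventually_nhds_le_map {G : E → Z} {G' : E →L[ℝ] Z} {a : E}
    (hG : HasStrictFDerivAt G G' a) (hs : Function.Surjective G') :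
    ∀ᶠ x in 𝓝 a, 𝓝 (G x) ≤ map G (𝓝 x) := by
  have : CompleteSpace Z := FiniteDimensional.complete ℝ Z
  set e := hG.implicitToOpenPartialHomeomorph G G' (LinearMap.range_eq_top.2 hs)
  have hfst : ∀ x, (e x).1 = G x := hG.implicitToOpenPartialHomeomorph_fst _
  filter_upwards [e.open_source.mem_nhds (hG.mem_implicitToOpenPartialHomeomorph_source _)]
    with x hx
  have h : map G (𝓝 x) = 𝓝 (G x) := by
    have h1 : G = Prod.fst ∘ e := funext fun x => (hfst x).symm
    conv_lhs => rw [h1, ← map_map, e.map_nhds_eq hx, map_fst_nhds, hfst]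
  exact h.ge

/-- Preimages of convex sets under a submersion are locally connected, uniformly. -/
theorem HasStrictFDerivAt.exists_nhds_isPreconnected {G : E → Z} {G' : E →L[ℝ] Z} {a : E}
    (hG : HasStrictFDerivAt G G' a) (hs : Function.Surjective G') {U : Set E} (hU : U ∈ 𝓝 a) :
    ∃ O ∈ 𝓝 a, ∀ C : Set Z, Convex ℝ C → ∀ z ∈ O, ∀ z' ∈ O, G z ∈ C → G z' ∈ C →
      ∃ P, IsPreconnected P ∧ P ⊆ U ∧ z ∈ P ∧ z' ∈ P ∧ ∀ y ∈ P, G y ∈ C := by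
  have : CompleteSpace Z := FiniteDimensional.complete ℝ Z
  set e := hG.implicitToOpenPartialHomeomorph G G' (LinearMap.range_eq_top.2 hs)
  have hfst : ∀ x, (e x).1 = G x := hG.implicitToOpenPartialHomeomorph_fst _
  have ha : a ∈ e.source := hG.mem_implicitToOpenPartialHomeomorph_source _
  have hT : e.target ∩ e.symm ⁻¹' U ∈ 𝓝 (e a) :=
    inter_mem (e.open_target.mem_nhds (e.map_source ha))
      (e.continuousAt_symm (e.map_source ha) (by rwa [e.left_inv ha]))
  obtain ⟨r, hr, hball⟩ := Metric.mem_nhds_iff.1 hT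
  refine ⟨e.source ∩ e ⁻¹' Metric.ball (e a) r, inter_mem (e.open_source.mem_nhds ha)
    (e.continuousAt ha (Metric.ball_mem_nhds _ hr)), ?_⟩
  rintro C hC z ⟨hz, hzr⟩ z' ⟨hz', hzr'⟩ hzC hzC'
  -- In the implicit function chart the preimage of `C` is a cylinder, whose intersection with a
  -- ball is convex.
  have hconv : Convex ℝ (Metric.ball (e a) r ∩ Prod.fst ⁻¹' C) :=
    (convex_ball _ _).inter (hC.linear_preimage (LinearMap.fst ℝ Z _))
  refine ⟨e.symm '' (Metric.ball (e a) r ∩ Prod.fst ⁻¹' C),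
    hconv.isPreconnected.image _ (e.continuousOn_symm.mono fun y hy => (hball hy.1).1), ?_,
    ⟨e z, ⟨hzr, ?_⟩, e.left_inv hz⟩, ⟨e z', ⟨hzr', ?_⟩, e.left_inv hz'⟩, ?_⟩
  · rintro _ ⟨y, hy, rfl⟩
    exact (hball hy.1).2
  · rwa [mem_preimage, hfst]
  · rwa [mem_preimage, hfst]
  · rintro _ ⟨y, hy, rfl⟩
    rw [← hfst, e.right_inv (hball hy.1).1]
    exact hy.2

variable {H : Type*} [TopologicalSpace H] {I : ModelWithCorners ℝ E H}
  [NormedAddCommGroup F] [NormedSpace ℝ F]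

/-- A map `g` on the model space `H` which, near `a`, is the composition of a submersion `G` of
the ambient space and a linear map, where `H` is the preimage under `G` of a convex set. -/
theorem isFibrewiseConnectedAt_and_eventually_nhds_le_map {g : H → F} {a : H} {G : E → Z}
    {G' : E →L[ℝ] Z} (hG : HasStrictFDerivAt G G' (I a)) (hs : Function.Surjective G')
    (π : Z →ₗ[ℝ] F) {K : Set Z} (hKc : Convex ℝ K)
    (hK : ∀ᶠ x in 𝓝 (I a), x ∈ range I ↔ G x ∈ K)
    (hg : ∀ᶠ x in 𝓝 (I a), x ∈ range I → g (I.symm x) = π (G x))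
    (hπ : ∀ z ∈ K, 𝓝 (π z) ≤ map π (𝓝[K] z)) :
    IsFibrewiseConnectedAt g a ∧ ∀ᶠ x in 𝓝 a, 𝓝 (g x) ≤ map g (𝓝 x) := by
  constructor
  · intro U hU
    have hU' : I.symm ⁻¹' U ∈ 𝓝 (I a) :=
      I.continuous_symm.continuousAt (by rwa [I.left_inv])
    obtain ⟨O, hO, h⟩ := hG.exists_nhds_isPreconnected hs (inter_mem (inter_mem hU' hK) hg)
    refine ⟨I ⁻¹' (O ∩ ({x | x ∈ range I ↔ G x ∈ K} ∩
      {x | x ∈ range I → g (I.symm x) = π (G x)})), I.continuous.continuousAt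
      (inter_mem hO (inter_mem hK hg)), ?_⟩
    rintro z ⟨hz, hz1, hz2⟩ z' ⟨hz', hz1', hz2'⟩ hzz'
    have e1 := hz2 (mem_range_self z)
    have e2 := hz2' (mem_range_self z')
    rw [I.left_inv] at e1 e2
    -- Near `a`, the fibre of `g` through `z` is the preimage under `G` of the convex set `K ∩ π ⁻¹'
    -- {g z}`.
    obtain ⟨P, hP, hPU, hzP, hzP', hPC⟩ := h (K ∩ π ⁻¹' {g z})
      (hKc.inter ((convex_singleton _).linear_preimage π)) (I z) hz (I z') hz'
      ⟨hz1.1 (mem_range_self z), e1.symm⟩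
      ⟨hz1'.1 (mem_range_self z'), e2.symm.trans hzz'.symm⟩
    refine ⟨I.symm '' P, hP.image _ I.continuous_symm.continuousOn, ?_, ⟨_, hzP, I.left_inv z⟩,
      ⟨_, hzP', I.left_inv z'⟩, ?_⟩
    · rintro _ ⟨y, hy, rfl⟩
      exact (hPU hy).1.1
    · rintro _ ⟨y, hy, rfl⟩
      have h1 : y ∈ range I ↔ G y ∈ K := (hPU hy).1.2
      have h2 : y ∈ range I → g (I.symm y) = π (G y) := (hPU hy).2
      rw [h2 (h1.2 (hPC y hy).1)]
      exact (hPC y hy).2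
  · have hop := hG.eventually_nhds_le_map hs
    have hall : ∀ᶠ x in 𝓝 (I a), 𝓝 (G x) ≤ map G (𝓝 x) ∧
        (∀ᶠ x' in 𝓝 x, x' ∈ range I ↔ G x' ∈ K) ∧
        ∀ᶠ x' in 𝓝 x, x' ∈ range I → g (I.symm x') = π (G x') :=
      hop.and (hK.eventually_nhds.and hg.eventually_nhds)
    filter_upwards [I.continuous.continuousAt hall] with h hh
    obtain ⟨h1, h2, h3⟩ : 𝓝 (G (I h)) ≤ map G (𝓝 (I h)) ∧
        (∀ᶠ x' in 𝓝 (I h), x' ∈ range I ↔ G x' ∈ K) ∧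
        ∀ᶠ x' in 𝓝 (I h), x' ∈ range I → g (I.symm x') = π (G x') := hh
    have hKh : G (I h) ∈ K := h2.self_of_nhds.1 (mem_range_self h)
    have hgh : g h = π (G (I h)) := by
      have := h3.self_of_nhds (mem_range_self h)
      rwa [I.left_inv] at this
    intro W hW
    have hV : g ⁻¹' W ∈ 𝓝 h := hW
    have hV' : I.symm ⁻¹' (g ⁻¹' W) ∈ 𝓝 (I h) :=
      I.continuous_symm.continuousAt (by rwa [I.left_inv])
    -- `G` is open in the ambient space and `π` is open on `K`; nearby points with `G x ∈ K` lie in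
    -- the range of `I`, so the two combine to openness of `g`.
    have hM := h1 (image_mem_map (inter_mem hV' (inter_mem h2 h3)))
    have hM' := hπ _ hKh (image_mem_map
      (inter_mem (mem_nhdsWithin_of_mem_nhds hM) self_mem_nhdsWithin))
    rw [hgh]
    refine mem_of_superset hM' ?_
    rintro _ ⟨_, ⟨⟨x, ⟨hx1, hx2, hx3⟩, rfl⟩, hxK⟩, rfl⟩
    have hx2' : x ∈ range I ↔ G x ∈ K := hx2
    have hx3' : x ∈ range I → g (I.symm x) = π (G x) := hx3
    rw [← hx3' (hx2'.2 hxK)]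
    exact hx1

/-- A map on the model space whose differential at an interior point is surjective is open and
fibrewise connected near that point. -/
theorem isFibrewiseConnectedAt_of_interior [FiniteDimensional ℝ F] {g : H → F} {a : H}
    (ha : range I ∈ 𝓝 (I a)) (hg : ContDiffAt ℝ 1 (g ∘ I.symm) (I a))
    (hs : Function.Surjective (fderiv ℝ (g ∘ I.symm) (I a))) :
    IsFibrewiseConnectedAt g a ∧ ∀ᶠ x in 𝓝 a, 𝓝 (g x) ≤ map g (𝓝 x) := by
  refine isFibrewiseConnectedAt_and_eventually_nhds_le_map (hg.hasStrictFDerivAt (by simp)) hs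
    LinearMap.id (K := univ) convex_univ ?_ ?_ ?_
  · filter_upwards [ha] with x hx
    simp [hx]
  · exact Eventually.of_forall fun x _ => rfl
  · intro z _
    simp

end Strict

/-! ### Extension across the boundary hyperplane -/

section HalfSpaceExtension

variable {k : ℕ}

theorem EuclideanSpace.norm_le_norm_of_abs_le {ι : Type*} [Fintype ι] {x y : EuclideanSpace ℝ ι}
    (h : ∀ i, |x i| ≤ |y i|) : ‖x‖ ≤ ‖y‖ := by
  rw [EuclideanSpace.norm_eq, EuclideanSpace.norm_eq]
  refine Real.sqrt_le_sqrt (Finset.sum_le_sum fun i _ => ?_)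
  simp only [Real.norm_eq_abs]
  exact pow_le_pow_left₀ (abs_nonneg _) (h i) 2

/-- Replace coordinate `0` of `x` by `t`. -/
def withZeroCoord (t : ℝ) (x : EuclideanSpace ℝ (Fin (k + 1))) : EuclideanSpace ℝ (Fin (k + 1)) :=
  WithLp.toLp 2 (Fin.cons t fun i => x i.succ)

@[simp]
theorem withZeroCoord_zero (t : ℝ) (x : EuclideanSpace ℝ (Fin (k + 1))) :
    withZeroCoord t x 0 = t := rfl

@[simp]
theorem withZeroCoord_succ (t : ℝ) (x : EuclideanSpace ℝ (Fin (k + 1))) (i : Fin k) :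
    withZeroCoord t x i.succ = x i.succ := rfl

theorem withZeroCoord_self (x : EuclideanSpace ℝ (Fin (k + 1))) : withZeroCoord (x 0) x = x := by
  ext i
  refine Fin.cases rfl (fun _ => rfl) i

theorem norm_withZeroCoord_sub_le {s t : ℝ} {x y : EuclideanSpace ℝ (Fin (k + 1))}
    (h : |s - t| ≤ |x 0 - y 0|) : ‖withZeroCoord s x - withZeroCoord t y‖ ≤ ‖x - y‖ := by
  refine EuclideanSpace.norm_le_norm_of_abs_le fun i => ?_
  refine Fin.cases ?_ (fun j => ?_) i
  · simpa using h
  · simp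

variable {F : Type*} [NormedAddCommGroup F]

/-- The extension of a function from the half-space `{0 ≤ x 0}` by a reflection: it is `f` on the
half-space, and it is strictly differentiable where `f` is `C¹` up to the boundary. -/
def halfSpaceExtension (f : EuclideanSpace ℝ (Fin (k + 1)) → F)
    (x : EuclideanSpace ℝ (Fin (k + 1))) : F :=
  f (withZeroCoord (max (x 0) 0) x) - f (withZeroCoord (max (-x 0) 0) x) + f (withZeroCoord 0 x)

theorem halfSpaceExtension_of_nonneg (f : EuclideanSpace ℝ (Fin (k + 1)) → F)
    {x : EuclideanSpace ℝ (Fin (k + 1))} (hx : 0 ≤ x 0) : halfSpaceExtension f x = f x := by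
  simp [halfSpaceExtension, hx, withZeroCoord_self]

variable [NormedSpace ℝ F]

/-- The mean value inequality on `s ∩ ball a δ`, where the derivative within `s` differs from its
value at `a` by less than `c`. This is strict differentiability at `a` relative to `s`. -/
theorem Convex.exists_ball_norm_sub_le {E : Type*} [NormedAddCommGroup E] [NormedSpace ℝ E]
    {s : Set E} (hs : Convex ℝ s) (hsu : UniqueDiffOn ℝ s) {f : E → F} {a : E} (ha : a ∈ s)
    (hf : ContDiffWithinAt ℝ 1 f s a) {c : ℝ} (hc : 0 < c) :
    ∃ δ > 0, ∀ x ∈ s ∩ Metric.ball a δ, ∀ y ∈ s ∩ Metric.ball a δ,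
      ‖f x - f y - fderivWithin ℝ f s a (x - y)‖ ≤ c * ‖x - y‖ := by
  have hf' : ContDiffWithinAt ℝ (0 + 1) f s a := by simpa using hf
  obtain ⟨u, hu, -, f', hd, hcont⟩ :=
    (contDiffWithinAt_succ_iff_hasFDerivWithinAt (by simp)).1 hf'
  rw [insert_eq_of_mem ha] at hu
  have hau : a ∈ u := mem_of_mem_nhdsWithin ha hu
  have hfa : f' a = fderivWithin ℝ f s a :=
    (((hd a hau).mono_of_mem_nhdsWithin hu).fderivWithin (hsu a ha)).symm
  have hcl : ∀ᶠ x in 𝓝[s] a, ‖f' x - f' a‖ < c := by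
    have h1 : ContinuousWithinAt f' s a := hcont.continuousWithinAt.mono_of_mem_nhdsWithin hu
    have h2 := (h1.sub_const (f' a)).norm
    exact Tendsto.eventually h2 (gt_mem_nhds (by simpa using hc))
  obtain ⟨δ, hδ, hball⟩ := Metric.mem_nhdsWithin_iff.1 (inter_mem hu hcl)
  rw [inter_comm] at hball
  refine ⟨δ, hδ, fun x hx y hy => ?_⟩
  rw [← hfa]
  exact (hs.inter (convex_ball a δ)).norm_image_sub_le_of_norm_hasFDerivWithin_le'
    (fun z hz => (hd z (hball hz).1).mono fun w hw => (hball hw).1)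
    (fun z hz => le_of_lt (hball hz).2) hy hx

/-- The three points at which `f` is evaluated depend on `x` in a 1-Lipschitz way, stay in the
half-space, and add up to `x` with the signs of the definition. Three estimates with constant `c /
3` therefore sum to the required one. -/
theorem hasStrictFDerivAt_halfSpaceExtension {f : EuclideanSpace ℝ (Fin (k + 1)) → F}
    {a : EuclideanSpace ℝ (Fin (k + 1))} (ha : a 0 = 0)
    (hf : ContDiffWithinAt ℝ 1 f {x | 0 ≤ x 0} a) :
    HasStrictFDerivAt (halfSpaceExtension f) (fderivWithin ℝ f {x | 0 ≤ x 0} a) a := by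
  set L := fderivWithin ℝ f {x | 0 ≤ x 0} a
  refine .of_isLittleO (Asymptotics.isLittleO_iff.2 fun c hc => ?_)
  have hsu : UniqueDiffOn ℝ {x : EuclideanSpace ℝ (Fin (k + 1)) | 0 ≤ x 0} := by
    rw [← range_modelWithCornersEuclideanHalfSpace]
    exact (𝓡∂ (k + 1)).uniqueDiffOn
  obtain ⟨δ, hδ, h⟩ := (EuclideanHalfSpace.convex (n := k + 1)).exists_ball_norm_sub_le hsu
    (show 0 ≤ a 0 from ha.ge) hf (show 0 < c / 3 by positivity)
  -- Here `t` stands for each of `s ↦ max s 0`, `s ↦ max (-s) 0` and `0`; since `t 0 = 0` and `a 0 =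
  -- 0`, the modified point is no farther from `a` than `x`.
  have hnear : ∀ t : ℝ → ℝ, (∀ s, 0 ≤ t s) → (∀ s s', |t s - t s'| ≤ |s - s'|) → t 0 = 0 →
      ∀ x ∈ Metric.ball a δ, withZeroCoord (t (x 0)) x ∈
        {x : EuclideanSpace ℝ (Fin (k + 1)) | 0 ≤ x 0} ∩ Metric.ball a δ := by
    intro t ht0 ht1 ht x hx
    refine ⟨ht0 _, ?_⟩
    rw [mem_ball_iff_norm] at hx ⊢
    refine lt_of_le_of_lt ?_ hx
    conv_lhs => rw [← withZeroCoord_self a]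
    refine norm_withZeroCoord_sub_le ?_
    conv_lhs => rw [ha, ← ht, ← ha]
    exact ht1 _ _
  have key : ∀ t : ℝ → ℝ, (∀ s, 0 ≤ t s) → (∀ s s', |t s - t s'| ≤ |s - s'|) → t 0 = 0 →
      ∀ x ∈ Metric.ball a δ, ∀ y ∈ Metric.ball a δ,
      ‖f (withZeroCoord (t (x 0)) x) - f (withZeroCoord (t (y 0)) y) -
        L (withZeroCoord (t (x 0)) x - withZeroCoord (t (y 0)) y)‖ ≤ c / 3 * ‖x - y‖ := by
    intro t ht0 ht1 ht x hx y hy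
    refine (h _ (hnear t ht0 ht1 ht x hx) _ (hnear t ht0 ht1 ht y hy)).trans ?_
    gcongr
    exact norm_withZeroCoord_sub_le (ht1 _ _)
  filter_upwards [prod_mem_nhds (Metric.ball_mem_nhds a hδ) (Metric.ball_mem_nhds a hδ)]
  rintro ⟨x, y⟩ ⟨hx, hy⟩
  have k1 := key (fun s => max s 0) (fun s => le_max_right _ _)
    (fun s s' => abs_max_sub_max_le_abs s s' 0) (by simp) x hx y hy
  have k2 := key (fun s => max (-s) 0) (fun s => le_max_right _ _)
    (fun s s' => by
      have := abs_max_sub_max_le_abs (-s) (-s') 0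
      rwa [neg_sub_neg, abs_sub_comm s'] at this) (by simp) x hx y hy
  have k3 := key (fun s => 0) (fun s => le_rfl) (fun s s' => by simp) rfl x hx y hy
  have hdec : ∀ z : EuclideanSpace ℝ (Fin (k + 1)), z = withZeroCoord (max (z 0) 0) z -
      withZeroCoord (max (-z 0) 0) z + withZeroCoord 0 z := by
    intro z
    ext i
    refine Fin.cases ?_ (fun j => ?_) i
    · rcases le_total 0 (z 0) with h0 | h0 <;> simp [h0]
    · simp
  have hL : L (x - y) =
      L (withZeroCoord (max (x 0) 0) x - withZeroCoord (max (y 0) 0) y) -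
      L (withZeroCoord (max (-x 0) 0) x - withZeroCoord (max (-y 0) 0) y) +
      L (withZeroCoord 0 x - withZeroCoord 0 y) := by
    conv_lhs => rw [hdec x, hdec y]
    rw [← map_sub, ← map_add]
    congr 1
    abel
  have heq : halfSpaceExtension f x - halfSpaceExtension f y - L (x - y) =
      (f (withZeroCoord (max (x 0) 0) x) - f (withZeroCoord (max (y 0) 0) y) -
        L (withZeroCoord (max (x 0) 0) x - withZeroCoord (max (y 0) 0) y)) -
      (f (withZeroCoord (max (-x 0) 0) x) - f (withZeroCoord (max (-y 0) 0) y) -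
        L (withZeroCoord (max (-x 0) 0) x - withZeroCoord (max (-y 0) 0) y)) +
      (f (withZeroCoord 0 x) - f (withZeroCoord 0 y) -
        L (withZeroCoord 0 x - withZeroCoord 0 y)) := by
    rw [hL]
    unfold halfSpaceExtension
    abel
  rw [heq]
  calc _ ≤ c / 3 * ‖x - y‖ + c / 3 * ‖x - y‖ + c / 3 * ‖x - y‖ :=
        (norm_add_le _ _).trans (add_le_add ((norm_sub_le _ _).trans (add_le_add k1 k2)) k3)
    _ = c * ‖x - y‖ := by ring

/-- A map on the half-space whose restriction to the boundary hyperplane has surjective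
differential at a boundary point is open and fibrewise connected near that point. -/
theorem isFibrewiseConnectedAt_of_boundary [FiniteDimensional ℝ F]
    {g : EuclideanHalfSpace (k + 1) → F} {a : EuclideanHalfSpace (k + 1)} (ha : a.1 0 = 0)
    (hg : ContDiffWithinAt ℝ 1 (g ∘ (𝓡∂ (k + 1)).symm) (range (𝓡∂ (k + 1))) a.1)
    (hs : ∀ y, ∃ v, v 0 = 0 ∧
      fderivWithin ℝ (g ∘ (𝓡∂ (k + 1)).symm) (range (𝓡∂ (k + 1))) a.1 v = y) :
    IsFibrewiseConnectedAt g a ∧ ∀ᶠ x in 𝓝 a, 𝓝 (g x) ≤ map g (𝓝 x) := by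
  rw [range_modelWithCornersEuclideanHalfSpace] at hg hs
  have h1 := hasStrictFDerivAt_halfSpaceExtension ha hg
  set L := fderivWithin ℝ (g ∘ (𝓡∂ (k + 1)).symm) {x | 0 ≤ x 0} a.1
  let p : EuclideanSpace ℝ (Fin (k + 1)) →L[ℝ] ℝ := EuclideanSpace.proj 0
  -- With coordinate `0` as a second component, the half-space becomes the preimage of the convex
  -- set `univ ×ˢ Ici 0`. The pair is a submersion because `L` is already surjective on vectors with
  -- `v 0 = 0`.
  have h2 : HasStrictFDerivAt (fun x => (halfSpaceExtension (g ∘ (𝓡∂ (k + 1)).symm) x, p x))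
      (L.prod p) ((𝓡∂ (k + 1)) a) := h1.prodMk p.hasStrictFDerivAt
  refine isFibrewiseConnectedAt_and_eventually_nhds_le_map (I := 𝓡∂ (k + 1)) h2 ?_
    (LinearMap.fst ℝ F ℝ) (K := univ ×ˢ Ici 0) (convex_univ.prod (convex_Ici 0)) ?_ ?_ ?_
  · rintro ⟨y, t⟩
    obtain ⟨v, hv, hvy⟩ := hs (y - L (EuclideanSpace.single 0 t))
    refine ⟨v + EuclideanSpace.single 0 t, ?_⟩
    simp [p, hvy, hv]
  · refine Eventually.of_forall fun x => ?_
    rw [range_modelWithCornersEuclideanHalfSpace]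
    change 0 ≤ x 0 ↔ _
    exact ⟨fun h => ⟨trivial, h⟩, fun h => h.2⟩
  · refine Eventually.of_forall fun x hx => ?_
    rw [range_modelWithCornersEuclideanHalfSpace] at hx
    exact (halfSpaceExtension_of_nonneg (g ∘ (𝓡∂ (k + 1)).symm) hx).symm
  · rintro ⟨y, t⟩ ⟨-, ht⟩
    rw [nhdsWithin_prod_eq, nhdsWithin_univ]
    have : (𝓝[Ici (0 : ℝ)] t).NeBot := mem_closure_iff_nhdsWithin_neBot.1 (subset_closure ht)
    exact (map_fst_prod (𝓝 y) (𝓝[Ici (0 : ℝ)] t)).ge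

end HalfSpaceExtension

end LocalSubmersion

/-! ### The boundary definite fold normal form -/

section FoldForm

open Set Filter Topology

variable {n m : ℕ}

/-- The quadratic part of the boundary definite fold normal form. -/
def foldQuad (m : ℕ) (x : EuclideanSpace ℝ (Fin (n + 1))) : ℝ :=
  ∑ j : Fin n, if m ≤ j.val then x j.succ ^ 2 else 0

theorem foldQuad_nonneg (x : EuclideanSpace ℝ (Fin (n + 1))) : 0 ≤ foldQuad m x :=
  Finset.sum_nonneg fun j _ => by split_ifs <;> positivity

theorem sq_le_foldQuad (x : EuclideanSpace ℝ (Fin (n + 1))) {j : Fin n} (hj : m ≤ j.val) :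
    x j.succ ^ 2 ≤ foldQuad m x := by
  have h := Finset.single_le_sum (f := fun j : Fin n => if m ≤ j.val then x j.succ ^ 2 else 0)
    (fun j _ => by split_ifs <;> positivity) (Finset.mem_univ j)
  rw [if_pos hj] at h
  exact h

theorem continuous_foldQuad : Continuous (foldQuad m : EuclideanSpace ℝ (Fin (n + 1)) → ℝ) := by
  unfold foldQuad
  refine continuous_finsetSum _ fun j _ => ?_
  split_ifs
  · fun_prop
  · exact continuous_const

/-- The fibres of the normal form are graphs over sublevel sets of `foldQuad`; convexity makes these
connected. -/
theorem convexOn_foldQuad :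
    ConvexOn ℝ univ (foldQuad m : EuclideanSpace ℝ (Fin (n + 1)) → ℝ) := by
  have h : (foldQuad m : EuclideanSpace ℝ (Fin (n + 1)) → ℝ) =
      ∑ j : Fin n, fun x => if m ≤ j.val then x j.succ ^ 2 else 0 := by
    ext x
    simp [foldQuad]
  rw [h]
  refine Finset.sum_induction _ (fun f => ConvexOn ℝ univ f) (fun _ _ hf hg => hf.add hg)
    (convexOn_const 0 convex_univ) fun j _ => ?_
  by_cases hj : m ≤ j.val
  · simp only [hj, if_true]
    exact (even_two.convexOn_pow (𝕜 := ℝ)).comp_linearMap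
      (EuclideanSpace.proj j.succ : EuclideanSpace ℝ (Fin (n + 1)) →L[ℝ] ℝ).toLinearMap
  · simp only [hj, if_false]
    exact convexOn_const 0 convex_univ

theorem boundaryFoldForm_zero (h : m < n) (x : EuclideanSpace ℝ (Fin (n + 1))) :
    boundaryFoldForm n m h x 0 = foldQuad m x + x 0 := by
  change (∑ i ∈ Finset.univ.filter (fun i : Fin (n + 1) => m < i.val), x i ^ 2) + x 0 = _
  rw [Finset.sum_filter, Fin.sum_univ_succ]
  simp [foldQuad]

theorem boundaryFoldForm_succ (h : m < n) (x : EuclideanSpace ℝ (Fin (n + 1))) (j : Fin m) :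
    boundaryFoldForm n m h x j.succ = x (Fin.castLE h.le j).succ := rfl

theorem contDiff_boundaryFoldForm (h : m < n) : ContDiff ℝ ∞ (boundaryFoldForm n m h) := by
  rw [contDiff_euclidean]
  intro i
  refine Fin.cases ?_ (fun j => ?_) i
  · refine ContDiff.add (ContDiff.sum fun i _ => ?_) (contDiff_euclidean.1 contDiff_id 0)
    exact (contDiff_euclidean.1 contDiff_id i).pow 2
  · exact contDiff_euclidean.1 contDiff_id _

/-- The boundary definite fold normal form as a map between half-spaces. -/
def halfSpaceFold (n m : ℕ) (h : m < n) (x : EuclideanHalfSpace (n + 1)) :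
    EuclideanHalfSpace (m + 1) :=
  ⟨boundaryFoldForm n m h x.1, by
    rw [boundaryFoldForm_zero]
    exact add_nonneg (foldQuad_nonneg _) x.2⟩

/-- Points with the same last coordinates as the multiple `s • x`, with the other coordinates given
by `t` and `y`. -/
def foldLift (t s : ℝ) (x : EuclideanSpace ℝ (Fin (n + 1))) (y : EuclideanSpace ℝ (Fin (m + 1))) :
    EuclideanSpace ℝ (Fin (n + 1)) :=
  WithLp.toLp 2 (Fin.cons t fun j : Fin n =>
    if hj : j.val < m then y (⟨j.val, hj⟩ : Fin m).succ else s * x j.succ)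

theorem foldLift_zero (t s : ℝ) (x : EuclideanSpace ℝ (Fin (n + 1)))
    (y : EuclideanSpace ℝ (Fin (m + 1))) : foldLift t s x y 0 = t := rfl

theorem foldLift_succ (t s : ℝ) (x : EuclideanSpace ℝ (Fin (n + 1)))
    (y : EuclideanSpace ℝ (Fin (m + 1))) (j : Fin n) : foldLift t s x y j.succ =
      if hj : j.val < m then y (⟨j.val, hj⟩ : Fin m).succ else s * x j.succ := rfl

theorem foldQuad_foldLift (t s : ℝ) (x : EuclideanSpace ℝ (Fin (n + 1)))
    (y : EuclideanSpace ℝ (Fin (m + 1))) :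
    foldQuad m (foldLift t s x y) = s ^ 2 * foldQuad m x := by
  unfold foldQuad
  rw [Finset.mul_sum]
  refine Finset.sum_congr rfl fun j _ => ?_
  rw [foldLift_succ]
  by_cases hj : m ≤ j.val
  · simp [hj, not_lt.2 hj, mul_pow]
  · simp [hj]

/-- `hts` is the equation for target coordinate `0`, and the other target coordinates are copied
from `y`. Choosing `t` and `s` as functions of `y` yields sections of the normal form. -/
theorem boundaryFoldForm_foldLift (h : m < n) {t s : ℝ} {x : EuclideanSpace ℝ (Fin (n + 1))}
    {y : EuclideanSpace ℝ (Fin (m + 1))} (hts : s ^ 2 * foldQuad m x + t = y 0) :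
    boundaryFoldForm n m h (foldLift t s x y) = y := by
  ext i
  refine Fin.cases ?_ (fun j => ?_) i
  · rw [boundaryFoldForm_zero, foldQuad_foldLift, foldLift_zero, hts]
  · rw [boundaryFoldForm_succ, foldLift_succ]
    simp

theorem foldLift_boundaryFoldForm (h : m < n) {t s : ℝ} {x : EuclideanSpace ℝ (Fin (n + 1))}
    (ht : t = x 0) (hs : ∀ j : Fin n, m ≤ j.val → s * x j.succ = x j.succ) :
    foldLift t s x (boundaryFoldForm n m h x) = x := by
  ext i
  refine Fin.cases ht (fun j => ?_) i
  rw [foldLift_succ]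
  split_ifs with hj
  · rw [boundaryFoldForm_succ]
    rfl
  · exact hs j (not_lt.1 hj)

theorem continuous_foldLift {A : Type*} [TopologicalSpace A] {t s : A → ℝ}
    {x : EuclideanSpace ℝ (Fin (n + 1))} {y : A → EuclideanSpace ℝ (Fin (m + 1))}
    (ht : Continuous t) (hs : Continuous s) (hy : Continuous y) :
    Continuous fun a => foldLift (t a) (s a) x (y a) := by
  refine (PiLp.continuous_toLp 2 _).comp (continuous_pi fun i => ?_)
  refine Fin.cases ht (fun j => ?_) i
  simp only [Fin.cons_succ]
  split_ifs <;> fun_prop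

/-- The section pushes `𝓝 (f a)` into `𝓝 a`, and `f` brings it back unchanged. -/
theorem nhds_le_map_of_section {A B : Type*} [TopologicalSpace A] [TopologicalSpace B] {f : A → B}
    {σ : B → A} {a : A} (hσ : ContinuousAt σ (f a)) (ha : σ (f a) = a) (hf : ∀ b, f (σ b) = b) :
    𝓝 (f a) ≤ map f (𝓝 a) := by
  have h : map f (map σ (𝓝 (f a))) = 𝓝 (f a) := by
    rw [map_map, show f ∘ σ = id from funext hf, map_id]
  rw [← h]
  refine map_mono ?_
  have := hσ.tendsto
  rwa [ha] at this

/-- The fold normal form is open as a map between half-spaces. -/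
theorem nhds_le_map_halfSpaceFold (h : m < n) (x : EuclideanHalfSpace (n + 1)) :
    𝓝 (halfSpaceFold n m h x) ≤ map (halfSpaceFold n m h) (𝓝 x) := by
  have hy0 : Continuous fun y : EuclideanHalfSpace (m + 1) => y.1 0 :=
    (PiLp.continuous_apply 2 _ 0).comp continuous_subtype_val
  set c : ℝ := foldQuad m x.1 + x.1 0 with hc
  have hfx : (halfSpaceFold n m h x).1 0 = c := boundaryFoldForm_zero h x.1
  have hc0 : 0 ≤ c := add_nonneg (foldQuad_nonneg _) x.2
  -- If `c = 0`, the squared coordinates of `x` vanish and the lift puts `y.1 0` into coordinate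
  -- `0`. If `c > 0`, coordinate `0` and the quadratic part are both multiplied by `y.1 0 / c`,
  -- which is nonnegative and equals `1` at the image of `x`.
  rcases hc0.eq_or_lt with hc0 | hc0
  · have hx0 : x.1 0 = 0 := by linarith [foldQuad_nonneg (m := m) x.1, x.2]
    have hq0 : foldQuad m x.1 = 0 := by linarith
    have hxj : ∀ j : Fin n, m ≤ j.val → x.1 j.succ = 0 := by
      intro j hj
      have := sq_le_foldQuad x.1 hj
      rw [hq0] at this
      exact pow_eq_zero_iff two_ne_zero |>.1 (le_antisymm this (sq_nonneg _))
    refine nhds_le_map_of_section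
      (σ := fun y => ⟨foldLift (y.1 0) 0 x.1 y.1, y.2⟩) ?_ ?_ ?_
    · exact (Continuous.subtype_mk
        (continuous_foldLift hy0 continuous_const continuous_subtype_val) _).continuousAt
    · refine Subtype.ext (foldLift_boundaryFoldForm h ?_ ?_)
      · rw [hfx, ← hc0, hx0]
      · intro j hj
        rw [hxj j hj, mul_zero]
    · intro y
      exact Subtype.ext (boundaryFoldForm_foldLift h (by simp))
  · refine nhds_le_map_of_section
      (σ := fun y => ⟨foldLift (y.1 0 / c * x.1 0) (Real.sqrt (y.1 0 / c)) x.1 y.1,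
        mul_nonneg (div_nonneg y.2 hc0.le) x.2⟩) ?_ ?_ ?_
    · exact (Continuous.subtype_mk (continuous_foldLift ((hy0.div_const c).mul_const _)
        (hy0.div_const c).sqrt continuous_subtype_val) _).continuousAt
    · refine Subtype.ext (foldLift_boundaryFoldForm h ?_ ?_)
      · rw [hfx, div_self hc0.ne', one_mul]
      · intro j hj
        rw [hfx, div_self hc0.ne', Real.sqrt_one, one_mul]
    · intro y
      refine Subtype.ext (boundaryFoldForm_foldLift h ?_)
      rw [Real.sq_sqrt (div_nonneg y.2 hc0.le), ← mul_add, ← hc, div_mul_cancel₀ _ hc0.ne']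

/-- On the half-space `foldQuad` and coordinate `0` are both nonnegative, so their sum vanishes only
if both do. -/
theorem eq_zero_of_boundaryFoldForm_eq_zero (h : m < n) {x : EuclideanHalfSpace (n + 1)}
    (hx : boundaryFoldForm n m h x.1 = 0) : x = 0 := by
  have h0 : foldQuad m x.1 + x.1 0 = 0 := by rw [← boundaryFoldForm_zero h, hx]; rfl
  have hx0 : x.1 0 = 0 := by linarith [foldQuad_nonneg (m := m) x.1, x.2]
  have hq0 : foldQuad m x.1 = 0 := by linarith [foldQuad_nonneg (m := m) x.1, x.2]
  apply EuclideanHalfSpace.ext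
  ext i
  refine Fin.cases hx0 (fun j => ?_) i
  by_cases hj : j.val < m
  · have := boundaryFoldForm_succ h x.1 ⟨j.val, hj⟩
    rw [hx] at this
    exact this.symm
  · have := sq_le_foldQuad x.1 (not_lt.1 hj)
    rw [hq0] at this
    exact pow_eq_zero_iff two_ne_zero |>.1 (le_antisymm this (sq_nonneg _))

/-- The fibres of the fold normal form near the fold point are discs. -/
theorem isFibrewiseConnectedAt_boundaryFoldForm (h : m < n) :
    IsFibrewiseConnectedAt
      (fun x : EuclideanHalfSpace (n + 1) => boundaryFoldForm n m h x.1) 0 := by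
  intro U hU
  have hU' : (fun v : Fin (n + 1) → ℝ => (𝓡∂ (n + 1)).symm (WithLp.toLp 2 v)) ⁻¹' U ∈
      𝓝 (0 : Fin (n + 1) → ℝ) := by
    have hcont : Continuous fun v : Fin (n + 1) → ℝ => (𝓡∂ (n + 1)).symm (WithLp.toLp 2 v) :=
      (𝓡∂ (n + 1)).continuous_symm.comp (PiLp.continuous_toLp 2 _)
    refine hcont.continuousAt ?_
    have h0 : (𝓡∂ (n + 1)).symm (WithLp.toLp 2 (0 : Fin (n + 1) → ℝ)) = 0 :=
      (𝓡∂ (n + 1)).left_inv 0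
    rwa [h0]
  obtain ⟨ε₀, hε₀, hball₀⟩ := Metric.mem_nhds_iff.1 hU'
  -- The squared coordinates are bounded by `ε` when `c < ε ^ 2`; for coordinate `0` one also needs
  -- `ε ^ 2 ≤ ε`, hence `ε ≤ 1`.
  obtain ⟨ε, hε, hε1, hεε₀⟩ : ∃ ε > 0, ε ≤ 1 ∧ ε ≤ ε₀ :=
    ⟨min 1 ε₀, lt_min one_pos hε₀, min_le_left _ _, min_le_right _ _⟩
  have hball := (Metric.ball_subset_ball hεε₀).trans hball₀
  have hO : {x : EuclideanHalfSpace (n + 1) | (∀ i, |x.1 i| < ε) ∧ foldQuad m x.1 + x.1 0 < ε ^ 2} ∈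
      𝓝 (0 : EuclideanHalfSpace (n + 1)) := by
    have hcoord : ∀ i, Continuous fun x : EuclideanHalfSpace (n + 1) => x.1 i := fun i =>
      (PiLp.continuous_apply 2 _ i).comp continuous_subtype_val
    refine inter_mem ?_ ?_
    · refine eventually_all.2 fun i => ?_
      refine (hcoord i).abs.continuousAt.tendsto.eventually (gt_mem_nhds ?_)
      change |(0 : ℝ)| < ε
      simpa using hε
    · refine ((continuous_foldQuad.comp continuous_subtype_val).add
        (hcoord 0)).continuousAt.tendsto.eventually (gt_mem_nhds ?_)
      change foldQuad m (0 : EuclideanSpace ℝ (Fin (n + 1))) + (0 : ℝ) < ε ^ 2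
      simp [foldQuad, hε]
  refine ⟨_, hO, ?_⟩
  rintro z ⟨hz, hzc⟩ z' ⟨hz', -⟩ hzz'
  set c := foldQuad m z.1 + z.1 0 with hc
  -- The fibre through `z` as a graph over `foldQuad m v ≤ c`: squared coordinates come from `v`,
  -- the unsquared ones from the common value, and coordinate `0` is solved for.
  let T : EuclideanSpace ℝ (Fin (n + 1)) → EuclideanSpace ℝ (Fin (n + 1)) := fun v =>
    foldLift (c - foldQuad m v) 1 v (boundaryFoldForm n m h z.1)
  have hTcont : Continuous T := by
    refine (PiLp.continuous_toLp 2 _).comp (continuous_pi fun i => ?_)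
    refine Fin.cases (continuous_const.sub continuous_foldQuad) (fun j => ?_) i
    simp only [Fin.cons_succ]
    split_ifs <;> fun_prop
  have hT0 : ∀ v, foldQuad m v ≤ c → 0 ≤ T v 0 := fun v hv => sub_nonneg.2 hv
  have hTsymm : ∀ v, foldQuad m v ≤ c → ((𝓡∂ (n + 1)).symm (T v)).1 = T v := fun v hv =>
    (𝓡∂ (n + 1)).right_inv (by
      rw [range_modelWithCornersEuclideanHalfSpace]; exact hT0 v hv)
  have hTz : ∀ w : EuclideanHalfSpace (n + 1),
      boundaryFoldForm n m h w.1 = boundaryFoldForm n m h z.1 →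
      foldQuad m w.1 ≤ c ∧ (𝓡∂ (n + 1)).symm (T w.1) = w := by
    intro w hw
    have hwc : foldQuad m w.1 + w.1 0 = c := by
      rw [hc, ← boundaryFoldForm_zero h, ← boundaryFoldForm_zero h, hw]
    have hw0 := w.2
    have hq : foldQuad m w.1 ≤ c := by linarith
    refine ⟨hq, EuclideanHalfSpace.ext _ _ ?_⟩
    rw [hTsymm _ hq]
    simp only [T]
    rw [← hw]
    exact foldLift_boundaryFoldForm h (by linarith) (fun j _ => one_mul _)
  refine ⟨(fun v => (𝓡∂ (n + 1)).symm (T v)) '' {v | foldQuad m v ≤ c}, ?_, ?_,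
    ⟨z.1, hTz z rfl⟩, ⟨z'.1, hTz z' hzz'.symm⟩, ?_⟩
  · have hconv : Convex ℝ {v : EuclideanSpace ℝ (Fin (n + 1)) | foldQuad m v ≤ c} := by
      simpa using convexOn_foldQuad.convex_le c
    exact hconv.isPreconnected.image _
      ((𝓡∂ (n + 1)).continuous_symm.comp hTcont).continuousOn
  · rintro _ ⟨v, hv, rfl⟩
    have hv' : foldQuad m v ≤ c := hv
    have hTv : WithLp.ofLp (T v) ∈ Metric.ball (0 : Fin (n + 1) → ℝ) ε := ?_
    · exact hball hTv
    rw [mem_ball_zero_iff, pi_norm_lt_iff hε]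
    intro i
    rw [Real.norm_eq_abs]
    refine Fin.cases ?_ (fun j => ?_) i
    · change |c - foldQuad m v| < ε
      have := foldQuad_nonneg (m := m) v
      rw [abs_of_nonneg (by linarith)]
      nlinarith
    · change |T v j.succ| < ε
      simp only [T]
      rw [foldLift_succ]
      split_ifs with hj
      · exact hz _
      · have := sq_le_foldQuad v (not_lt.1 hj)
        rw [one_mul]
        exact abs_lt_of_sq_lt_sq (by linarith) hε.le
  · rintro _ ⟨v, hv, rfl⟩
    change boundaryFoldForm n m h ((𝓡∂ (n + 1)).symm (T v)).1 = _
    rw [hTsymm v hv]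
    refine boundaryFoldForm_foldLift h ?_
    rw [boundaryFoldForm_zero, ← hc]
    ring

/-- The differential of the restriction of the fold normal form to the boundary hyperplane is
surjective exactly where the folded coordinates do not all vanish. -/
theorem surjective_fderiv_boundaryFoldForm_boundaryIncl (h : m < n)
    (v : EuclideanSpace ℝ (Fin n)) :
    Function.Surjective (fderiv ℝ (fun v => boundaryFoldForm n m h (boundaryIncl n v).1) v) ↔
      ∃ j : Fin n, m ≤ j.val ∧ v j ≠ 0 := by
  set G := fun v => boundaryFoldForm n m h (boundaryIncl n v).1
  have hG : Differentiable ℝ G :=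
    ((contDiff_boundaryFoldForm h).comp (contDiff_boundaryIncl n)).differentiable (by simp)
  have hG0 : ∀ u, G u 0 = ∑ j : Fin n, if m ≤ j.val then u j ^ 2 else 0 := by
    intro u
    simp only [G]
    rw [boundaryFoldForm_zero]
    exact add_zero _
  have hGs : ∀ u (j : Fin m), G u j.succ = u (Fin.castLE h.le j) := fun u j => rfl
  -- Components of the differential are computed along the lines `v + s • u`.
  have hcomp : ∀ (u : EuclideanSpace ℝ (Fin n)) (i : Fin (m + 1)) (d : ℝ),
      HasDerivAt (fun s : ℝ => G (v + s • u) i) d 0 → fderiv ℝ G v u i = d := by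
    intro u i d hd
    have h1 : HasDerivAt (fun s : ℝ => v + s • u) u 0 := by
      simpa using ((hasDerivAt_id (0 : ℝ)).smul_const u).const_add v
    have h2 : HasFDerivAt G (fderiv ℝ G v) (v + (0 : ℝ) • u) := by
      simpa using (hG v).hasFDerivAt
    have h3 := h2.comp_hasDerivAt (0 : ℝ) h1
    have h4 := ((EuclideanSpace.proj i :
      EuclideanSpace ℝ (Fin (m + 1)) →L[ℝ] ℝ).hasFDerivAt).comp_hasDerivAt (0 : ℝ) h3
    exact h4.unique hd
  constructor
  · intro hs
    by_contra! hne
    -- If the squared coordinates of `v` vanish, component `0` is a multiple of `s ^ 2` along every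
    -- line, so this vector cannot be in the image.
    obtain ⟨u, hu⟩ := hs (EuclideanSpace.single 0 1)
    have h0 : fderiv ℝ G v u 0 = 0 := by
      refine hcomp u 0 0 ?_
      have : ∀ s : ℝ, G (v + s • u) 0 = s ^ 2 * ∑ j : Fin n, if m ≤ j.val then u j ^ 2 else 0 := by
        intro s
        rw [hG0, Finset.mul_sum]
        refine Finset.sum_congr rfl fun j _ => ?_
        split_ifs with hj
        · simp [hne j hj, mul_pow]
        · simp
      simp only [this]
      simpa using ((hasDerivAt_id (0 : ℝ)).pow 2).mul_const
        (∑ j : Fin n, if m ≤ j.val then u j ^ 2 else 0)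
    rw [hu] at h0
    simp at h0
  · rintro ⟨j₀, hj₀, hv⟩ y
    -- Among the squared coordinates only `j₀` is moved; component `0` has partial derivative `2 * v
    -- j₀` there, which accounts for the denominator.
    let u : EuclideanSpace ℝ (Fin n) := WithLp.toLp 2 fun j =>
      if hj : j.val < m then y (⟨j.val, hj⟩ : Fin m).succ else
        if j = j₀ then y 0 / (2 * v j₀) else 0
    have hu : ∀ j, u j = if hj : j.val < m then y (⟨j.val, hj⟩ : Fin m).succ else
        if j = j₀ then y 0 / (2 * v j₀) else 0 := fun j => rfl
    refine ⟨u, ?_⟩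
    ext i
    refine Fin.cases ?_ (fun j => ?_) i
    · refine hcomp u 0 (y 0) ?_
      have hd : HasDerivAt (fun s : ℝ => G (v + s • u) 0)
          (∑ j : Fin n, if m ≤ j.val then 2 * v j * u j else 0) 0 := by
        simp only [hG0]
        refine HasDerivAt.fun_sum fun j _ => ?_
        split_ifs with hj
        · have h1 : HasDerivAt (fun s : ℝ => v j + s * u j) (u j) 0 := by
            simpa using ((hasDerivAt_id (0 : ℝ)).mul_const (u j)).const_add (v j)
          simpa using h1.fun_pow 2
        · exact hasDerivAt_const _ _
      convert hd using 1
      rw [Finset.sum_eq_single j₀]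
      · rw [if_pos hj₀, hu, dif_neg (not_lt.2 hj₀), if_pos rfl]
        field_simp
      · intro j _ hj
        split_ifs with hjm
        · rw [hu, dif_neg (not_lt.2 hjm), if_neg hj, mul_zero]
        · rfl
      · simp
    · refine hcomp u j.succ _ ?_
      simp only [hGs]
      have h1 : HasDerivAt (fun s : ℝ => v (Fin.castLE h.le j) + s * u (Fin.castLE h.le j))
          (u (Fin.castLE h.le j)) 0 := by
        simpa using ((hasDerivAt_id (0 : ℝ)).mul_const (u (Fin.castLE h.le j))).const_add
          (v (Fin.castLE h.le j))
      have h2 : u (Fin.castLE h.le j) = y j.succ := by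
        rw [hu]
        simp
      rw [← h2]
      exact h1

end FoldForm

/-! ### Manifolds with boundary immersed in Euclidean space in codimension zero -/

section HalfSpaceCharts

open Set Filter Topology

variable {k : ℕ} {W : Type*} [TopologicalSpace W]

/-- An open set on which `g`, followed by a chart of `ℝ^(k+1)`, is a homeomorphism onto an open
subset of the half-space. -/
structure HalfSpaceChartData (g : W → EuclideanSpace ℝ (Fin (k + 1))) where
  source : Set W
  ψ : OpenPartialHomeomorph (EuclideanSpace ℝ (Fin (k + 1))) (EuclideanSpace ℝ (Fin (k + 1)))
  open_source : IsOpen source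
  mem_maximalAtlas : ψ ∈ IsManifold.maximalAtlas (𝓡 (k + 1)) ∞ (EuclideanSpace ℝ (Fin (k + 1)))
  continuousOn : ContinuousOn g source
  injOn : InjOn g source
  mapsTo : MapsTo g source ψ.source
  nonneg : ∀ w ∈ source, 0 ≤ ψ (g w) 0
  isOpen_image : ∀ O ⊆ source, IsOpen O → IsOpen ((fun w => (𝓡∂ (k + 1)).symm (ψ (g w))) '' O)

namespace HalfSpaceChartData

variable {g : W → EuclideanSpace ℝ (Fin (k + 1))}

theorem coe_symm_apply (d : HalfSpaceChartData g) {w : W} (hw : w ∈ d.source) :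
    ((𝓡∂ (k + 1)).symm (d.ψ (g w))).1 = d.ψ (g w) :=
  (𝓡∂ (k + 1)).right_inv (by
    rw [range_modelWithCornersEuclideanHalfSpace]
    exact d.nonneg w hw)

theorem injOn_symm_comp (d : HalfSpaceChartData g) :
    InjOn (fun w => (𝓡∂ (k + 1)).symm (d.ψ (g w))) d.source := by
  intro w hw w' hw' h
  have h' := congrArg Subtype.val h
  simp only [d.coe_symm_apply hw, d.coe_symm_apply hw'] at h'
  exact d.injOn hw hw' (d.ψ.injOn (d.mapsTo hw) (d.mapsTo hw') h')

variable [Nonempty W]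

/-- The chart `w ↦ ψ (g w)` with values in the half-space. -/
def chart (d : HalfSpaceChartData g) : OpenPartialHomeomorph W (EuclideanHalfSpace (k + 1)) :=
  OpenPartialHomeomorph.ofContinuousOpenRestrict
    (d.injOn_symm_comp.toPartialEquiv (fun w => (𝓡∂ (k + 1)).symm (d.ψ (g w))) d.source)
    ((𝓡∂ (k + 1)).continuous_symm.comp_continuousOn
      (d.ψ.continuousOn.comp d.continuousOn d.mapsTo))
    (by
      intro (O : Set d.source) hO
      have h := d.isOpen_image _ (Subtype.coe_image_subset d.source O)
        (d.open_source.isOpenMap_subtype_val O hO)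
      rwa [image_image] at h)
    d.open_source

theorem coe_chart_apply (d : HalfSpaceChartData g) {w : W} (hw : w ∈ d.source) :
    (d.chart w).1 = d.ψ (g w) := d.coe_symm_apply hw

theorem apply_chart_symm (d : HalfSpaceChartData g) {x : EuclideanHalfSpace (k + 1)}
    (hx : x ∈ d.chart.target) : d.ψ (g (d.chart.symm x)) = x.1 := by
  rw [← d.coe_chart_apply (d.chart.map_target hx), d.chart.right_inv hx]

/-- The charted space structure whose charts are the charts of the given type. -/
@[reducible]
def chartedSpace (h : ∀ w, ∃ d : HalfSpaceChartData g, w ∈ d.source) :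
    ChartedSpace (EuclideanHalfSpace (k + 1)) W where
  atlas := {e | ∃ d : HalfSpaceChartData g, e = d.chart}
  chartAt w := (h w).choose.chart
  mem_chart_source w := (h w).choose_spec
  chart_mem_atlas _ := ⟨_, rfl⟩

/-- Both charts factor through `g`, so a transition map is `d'.ψ ∘ d.ψ.symm` on a part of the
half-space; `g` itself cancels. -/
theorem isManifold (h : ∀ w, ∃ d : HalfSpaceChartData g, w ∈ d.source) :
    letI := chartedSpace h
    IsManifold (𝓡∂ (k + 1)) ∞ W := by
  let _ := chartedSpace h
  refine isManifold_of_contDiffOn (𝓡∂ (k + 1)) ∞ W ?_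
  rintro _ _ ⟨d, rfl⟩ ⟨d', rfl⟩
  have h1 := (contMDiffOn_symm_of_mem_maximalAtlas d.mem_maximalAtlas).contDiffOn
  have h2 := (contMDiffOn_of_mem_maximalAtlas d'.mem_maximalAtlas).contDiffOn
  have key : ∀ x ∈ (𝓡∂ (k + 1)).symm ⁻¹' (d.chart.symm.trans d'.chart).source ∩
      range (𝓡∂ (k + 1)), x ∈ d.ψ.target ∧
        d.ψ.symm x = g (d.chart.symm ((𝓡∂ (k + 1)).symm x)) ∧
        d.chart.symm ((𝓡∂ (k + 1)).symm x) ∈ d'.source := by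
    rintro x ⟨⟨hx1, hx2⟩, hxr⟩
    have hx1' : (𝓡∂ (k + 1)).symm x ∈ d.chart.target := hx1
    have e1 := d.apply_chart_symm hx1'
    rw [show ((𝓡∂ (k + 1)).symm x).1 = x from (𝓡∂ (k + 1)).right_inv hxr] at e1
    have hs := d.mapsTo (d.chart.map_target hx1')
    refine ⟨?_, ?_, hx2⟩
    · rw [← e1]
      exact d.ψ.map_source hs
    · conv_lhs => rw [← e1]
      exact d.ψ.left_inv hs
  refine (h2.comp (h1.mono fun x hx => (key x hx).1) fun x hx => ?_).congr fun x hx => ?_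
  · rw [(key x hx).2.1]
    exact d'.mapsTo (key x hx).2.2
  · change (d'.chart (d.chart.symm ((𝓡∂ (k + 1)).symm x))).1 = d'.ψ (d.ψ.symm x)
    rw [d'.coe_chart_apply (key x hx).2.2, (key x hx).2.1]

theorem chart_mem_maximalAtlas (h : ∀ w, ∃ d : HalfSpaceChartData g, w ∈ d.source)
    (d : HalfSpaceChartData g) :
    letI := chartedSpace h
    d.chart ∈ IsManifold.maximalAtlas (𝓡∂ (k + 1)) ∞ W := by
  let _ := chartedSpace h
  have := isManifold h
  exact IsManifold.subset_maximalAtlas ⟨d, rfl⟩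

/-- Read in `d.chart` and `d.ψ`, the map is the inclusion of the half-space. The dimensions agree,
so the complement is `PUnit`. -/
theorem isImmersion (h : ∀ w, ∃ d : HalfSpaceChartData g, w ∈ d.source) :
    letI := chartedSpace h
    Manifold.IsImmersion (𝓡∂ (k + 1)) (𝓡 (k + 1)) ∞ g := by
  let _ := chartedSpace h
  have := isManifold h
  refine Manifold.IsImmersionOfComplement.isImmersion (F := PUnit) fun w => ?_
  obtain ⟨d, hd⟩ := h w
  refine .mk_of_charts (.prodUnique ℝ _ _) d.chart d.ψ hd (d.mapsTo hd)
    (chart_mem_maximalAtlas h d) d.mem_maximalAtlas d.mapsTo ?_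
  intro x hx
  rw [OpenPartialHomeomorph.extend_target] at hx
  change d.ψ (g (d.chart.symm ((𝓡∂ (k + 1)).symm x))) = x
  rw [d.apply_chart_symm hx.1]
  exact (𝓡∂ (k + 1)).right_inv hx.2

end HalfSpaceChartData

end HalfSpaceCharts

/-! ### Embedded submanifolds given by slice charts -/

section Slices

open Set Filter Topology

variable {E E' : Type*} [NormedAddCommGroup E] [NormedSpace ℝ E] [NormedAddCommGroup E']
  [NormedSpace ℝ E'] {X : Type*} [TopologicalSpace X] {S : Set X}
  {ι : E →L[ℝ] E'} {π : E' →L[ℝ] E}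

/-- The chart `c` flattens `S`: it maps it to the range of `ι`, with retraction `π`. -/
def IsSliceChart (S : Set X) (ι : E →L[ℝ] E') (π : E' →L[ℝ] E) (c : OpenPartialHomeomorph X E') :
    Prop :=
  ∀ z ∈ c.source, z ∈ S ↔ ι (π (c z)) = c z

/-- The chart of `S` induced by a chart flattening `S`. The point `p` only serves as a value of the
inverse outside the target. -/
def sliceChart (hπι : ∀ v, π (ι v) = v) (c : OpenPartialHomeomorph X E')
    (hc : IsSliceChart S ι π c) (p : S) : OpenPartialHomeomorph S E where
  toFun z := π (c z.1)
  invFun v := by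
    classical
    exact if h : ι v ∈ c.target then
      ⟨c.symm (ι v), (hc _ (c.map_target h)).2 (by rw [c.right_inv h, hπι])⟩
    else p
  source := {z | z.1 ∈ c.source}
  target := {v | ι v ∈ c.target}
  map_source' z hz := by
    have hz' : z.1 ∈ c.source := hz
    change ι (π (c z.1)) ∈ c.target
    rw [(hc _ hz').1 z.2]
    exact c.map_source hz'
  map_target' v hv := by
    have hv' : ι v ∈ c.target := hv
    simp only [hv', dif_pos]
    exact c.map_target hv'
  left_inv' z hz := by
    have hz' : z.1 ∈ c.source := hz
    have h1 := (hc _ hz').1 z.2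
    have h2 : ι (π (c z.1)) ∈ c.target := by
      rw [h1]; exact c.map_source hz'
    rw [dif_pos h2]
    apply Subtype.ext
    change c.symm (ι (π (c z.1))) = z.1
    rw [h1, c.left_inv hz']
  right_inv' v hv := by
    have hv' : ι v ∈ c.target := hv
    rw [dif_pos hv']
    change π (c (c.symm (ι v))) = v
    rw [c.right_inv hv', hπι]
  open_source := c.open_source.preimage continuous_subtype_val
  open_target := c.open_target.preimage ι.continuous
  continuousOn_toFun := by
    refine π.continuous.comp_continuousOn ?_
    exact c.continuousOn.comp continuous_subtype_val.continuousOn (fun x hx => hx)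
  continuousOn_invFun := by
    rw [Topology.IsInducing.subtypeVal.continuousOn_iff]
    have h : ContinuousOn (fun v => c.symm (ι v)) {v | ι v ∈ c.target} :=
      c.continuousOn_symm.comp ι.continuous.continuousOn (fun v hv => hv)
    refine h.congr (fun v hv => ?_)
    have hv' : ι v ∈ c.target := hv
    simp only [Function.comp_apply, hv', dif_pos]

theorem coe_sliceChart_symm_apply (hπι : ∀ v, π (ι v) = v) (c : OpenPartialHomeomorph X E')
    (hc : IsSliceChart S ι π c) (p : S) {v : E} (hv : v ∈ (sliceChart hπι c hc p).target) :
    ((sliceChart hπι c hc p).symm v).1 = c.symm (ι v) :=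
  congrArg Subtype.val (dif_pos hv)

variable [ChartedSpace E' X]

/-- A subset covered by charts flattening it is a charted space, with the slice charts. -/
@[reducible]
def sliceChartedSpace (hπι : ∀ v, π (ι v) = v)
    (h : ∀ p : S, ∃ c ∈ IsManifold.maximalAtlas 𝓘(ℝ, E') ∞ X,
      IsSliceChart S ι π c ∧ p.1 ∈ c.source) : ChartedSpace E S where
  atlas := {e | ∃ c ∈ IsManifold.maximalAtlas 𝓘(ℝ, E') ∞ X, ∃ hc p, e = sliceChart hπι c hc p}
  chartAt p := sliceChart hπι (h p).choose (h p).choose_spec.2.1 p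
  mem_chart_source p := (h p).choose_spec.2.2
  chart_mem_atlas p := ⟨_, (h p).choose_spec.1, (h p).choose_spec.2.1, p, rfl⟩

/-- Slice transitions are ambient transitions `c' ∘ c.symm` composed with the linear maps `ι` and
`π`. -/
theorem sliceIsManifold [IsManifold 𝓘(ℝ, E') ∞ X] (hπι : ∀ v, π (ι v) = v)
    (h : ∀ p : S, ∃ c ∈ IsManifold.maximalAtlas 𝓘(ℝ, E') ∞ X,
      IsSliceChart S ι π c ∧ p.1 ∈ c.source) :
    letI := sliceChartedSpace hπι h
    IsManifold 𝓘(ℝ, E) ∞ S := by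
  let _ := sliceChartedSpace hπι h
  refine isManifold_of_contDiffOn 𝓘(ℝ, E) ∞ S ?_
  rintro _ _ ⟨c, hcm, hc, p, rfl⟩ ⟨c', hcm', hc', p', rfl⟩
  have h1 : ContDiffOn ℝ ∞ (c' ∘ c.symm) (c.target ∩ c.symm ⁻¹' c'.source) :=
    ((contMDiffOn_of_mem_maximalAtlas hcm').comp
      ((contMDiffOn_symm_of_mem_maximalAtlas hcm).mono inter_subset_left)
      fun x hx => hx.2).contDiffOn
  have h2 := π.contDiff.comp_contDiffOn (h1.comp ι.contDiff.contDiffOn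
    (s := {v | ι v ∈ c.target ∧ c.symm (ι v) ∈ c'.source}) fun v hv => hv)
  refine h2.congr_mono ?_ ?_
  · rintro v ⟨⟨(hv : v ∈ (sliceChart hπι c hc p).target), -⟩, -⟩
    change π (c' ((sliceChart hπι c hc p).symm v).1) = π (c' (c.symm (ι v)))
    rw [coe_sliceChart_symm_apply hπι c hc p hv]
  · rintro v ⟨⟨(hv : v ∈ (sliceChart hπι c hc p).target), hv2⟩, -⟩
    have hv2' : ((sliceChart hπι c hc p).symm v).1 ∈ c'.source := hv2
    rw [coe_sliceChart_symm_apply hπι c hc p hv] at hv2'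
    exact ⟨hv, hv2'⟩

theorem sliceChart_mem_maximalAtlas [IsManifold 𝓘(ℝ, E') ∞ X] (hπι : ∀ v, π (ι v) = v)
    (h : ∀ p : S, ∃ c ∈ IsManifold.maximalAtlas 𝓘(ℝ, E') ∞ X,
      IsSliceChart S ι π c ∧ p.1 ∈ c.source) {c : OpenPartialHomeomorph X E'}
    (hcm : c ∈ IsManifold.maximalAtlas 𝓘(ℝ, E') ∞ X) (hc : IsSliceChart S ι π c) (p : S) :
    letI := sliceChartedSpace hπι h
    sliceChart hπι c hc p ∈ IsManifold.maximalAtlas 𝓘(ℝ, E) ∞ S := by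
  let _ := sliceChartedSpace hπι h
  have := sliceIsManifold hπι h
  exact IsManifold.subset_maximalAtlas ⟨c, hcm, hc, p, rfl⟩

/-- In slice charts the inclusion is `ι`, and its left inverse `π` splits `E'` as `E × π.ker`. -/
theorem sliceIsSmoothEmbedding [IsManifold 𝓘(ℝ, E') ∞ X] (hπι : ∀ v, π (ι v) = v)
    (h : ∀ p : S, ∃ c ∈ IsManifold.maximalAtlas 𝓘(ℝ, E') ∞ X,
      IsSliceChart S ι π c ∧ p.1 ∈ c.source) :
    letI := sliceChartedSpace hπι h
    Manifold.IsSmoothEmbedding 𝓘(ℝ, E) 𝓘(ℝ, E') ∞ (Subtype.val : S → X) := by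
  let _ := sliceChartedSpace hπι h
  have := sliceIsManifold hπι h
  refine ⟨Manifold.IsImmersionOfComplement.isImmersion (F := π.ker) fun p => ?_, .subtypeVal⟩
  obtain ⟨c, hcm, hc, hp⟩ := h p
  refine .mk_of_charts (ContinuousLinearEquiv.equivOfRightInverse π ι hπι).symm
    (sliceChart hπι c hc p) c hp hp (sliceChart_mem_maximalAtlas hπι h hcm hc p) hcm
    (fun z hz => hz) ?_
  intro v hv
  rw [OpenPartialHomeomorph.extend_target] at hv
  have hv' : v ∈ (sliceChart hπι c hc p).target := hv.1
  change c ((sliceChart hπι c hc p).symm v).1 = _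
  rw [coe_sliceChart_symm_apply hπι c hc p hv', c.right_inv hv']
  simp

end Slices

/-! ### Local structure of boundary special generic maps -/

section LocalStructure

open Set Filter Topology

variable {n m : ℕ} {N : Type*} [TopologicalSpace N] [ChartedSpace (EuclideanHalfSpace (n + 1)) N]
  {F : N → EuclideanSpace ℝ (Fin (m + 1))} {p : N}

theorem ContMDiffAt.contDiffWithinAt_comp_chartAt_symm
    (hF : ContMDiffAt (𝓡∂ (n + 1)) (𝓡 (m + 1)) ∞ F p) :
    ContDiffWithinAt ℝ 1 ((F ∘ (chartAt (EuclideanHalfSpace (n + 1)) p).symm) ∘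
      (𝓡∂ (n + 1)).symm) (range (𝓡∂ (n + 1)))
      (chartAt (EuclideanHalfSpace (n + 1)) p p).1 :=
  ((contMDiffAt_iff.1 hF).2).of_le (by norm_cast)

theorem ContMDiffAt.mfderiv_eq_fderivWithin_comp_chartAt_symm
    (hF : ContMDiffAt (𝓡∂ (n + 1)) (𝓡 (m + 1)) ∞ F p) :
    mfderiv (𝓡∂ (n + 1)) (𝓡 (m + 1)) F p =
      fderivWithin ℝ ((F ∘ (chartAt (EuclideanHalfSpace (n + 1)) p).symm) ∘
      (𝓡∂ (n + 1)).symm) (range (𝓡∂ (n + 1)))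
      (chartAt (EuclideanHalfSpace (n + 1)) p p).1 :=
  (hF.mdifferentiableAt (by simp)).mfderiv

/-- Near an interior point a submersion is open and has locally connected fibres. -/
theorem locallyFibreConnectedAt_of_notMem_boundary
    (hF : ContMDiffAt (𝓡∂ (n + 1)) (𝓡 (m + 1)) ∞ F p)
    (hs : Function.Surjective (mfderiv (𝓡∂ (n + 1)) (𝓡 (m + 1)) F p))
    (hp : p ∉ (𝓡∂ (n + 1)).boundary N) :
    LocallyFibreConnectedAt F p ∧ ∀ᶠ z in 𝓝 p, 𝓝 (F z) ≤ map F (𝓝 z) := by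
  set e := chartAt (EuclideanHalfSpace (n + 1)) p
  have he : p ∈ e.source := mem_chart_source _ p
  have hnhds : range (𝓡∂ (n + 1)) ∈ 𝓝 ((𝓡∂ (n + 1)) (e p)) := by
    have h1 : (𝓡∂ (n + 1)).IsInteriorPoint p :=
      ((𝓡∂ (n + 1)).isInteriorPoint_or_isBoundaryPoint p).resolve_right hp
    exact mem_interior_iff_mem_nhds.1 h1
  have hs' : Function.Surjective (fderivWithin ℝ ((F ∘ e.symm) ∘ (𝓡∂ (n + 1)).symm)
      (range (𝓡∂ (n + 1))) (e p).1) := by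
    rw [← hF.mfderiv_eq_fderivWithin_comp_chartAt_symm]
    exact hs
  have h := isFibrewiseConnectedAt_of_interior hnhds
    (hF.contDiffWithinAt_comp_chartAt_symm.contDiffAt hnhds)
    (by rwa [← fderivWithin_of_mem_nhds hnhds])
  exact ⟨locallyFibreConnectedAt_of_chart e he h.1, eventually_nhds_le_map_of_chart e he h.2⟩

/-! ### Behaviour at boundary points -/

section Boundary

variable [IsManifold (𝓡∂ (n + 1)) ∞ N]

theorem coe_boundaryChart_symm_apply {e : OpenPartialHomeomorph N (EuclideanHalfSpace (n + 1))}
    (he : e ∈ IsManifold.maximalAtlas (𝓡∂ (n + 1)) ∞ N) (p : (𝓡∂ (n + 1)).boundary N)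
    {v : EuclideanSpace ℝ (Fin n)} (hv : boundaryIncl n v ∈ e.target) :
    ((boundaryChart e he p).symm v).1 = e.symm (boundaryIncl n v) :=
  congrArg Subtype.val (dif_pos hv)

theorem contMDiff_boundary_subtype_val :
    ContMDiff (𝓡 n) (𝓡∂ (n + 1)) ∞ (Subtype.val : (𝓡∂ (n + 1)).boundary N → N) := by
  intro p
  rw [contMDiffAt_iff]
  refine ⟨continuous_subtype_val.continuousAt, ?_⟩
  set e := chartAt (EuclideanHalfSpace (n + 1)) p.1
  have he : e ∈ IsManifold.maximalAtlas (𝓡∂ (n + 1)) ∞ N := IsManifold.chart_mem_maximalAtlas p.1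
  have hp : p ∈ (boundaryChart e he p).source := mem_chart_source (EuclideanHalfSpace (n + 1)) p.1
  refine ContDiffWithinAt.congr_of_eventuallyEq (contDiff_boundaryIncl n).contDiffWithinAt
    ?_ ?_ (f₁ := fun v => (e ((boundaryChart e he p).symm v).1).1) (x := boundaryChart e he p p)
  · refine mem_nhdsWithin_of_mem_nhds ?_
    filter_upwards [(boundaryChart e he p).open_target.mem_nhds
      ((boundaryChart e he p).map_source hp)] with v hv
    rw [coe_boundaryChart_symm_apply he p hv, e.right_inv hv]
  · have hv := (boundaryChart e he p).map_source hp
    rw [coe_boundaryChart_symm_apply he p hv, e.right_inv hv]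

/-- Near a boundary point where the restriction to the boundary is a submersion, a map is open and
has locally connected fibres. -/
theorem locallyFibreConnectedAt_of_boundary (p : (𝓡∂ (n + 1)).boundary N)
    (hF : ContMDiff (𝓡∂ (n + 1)) (𝓡 (m + 1)) ∞ F) (hp : p ∉ boundarySingularSet n F) :
    LocallyFibreConnectedAt F p.1 ∧ ∀ᶠ z in 𝓝 p.1, 𝓝 (F z) ≤ map F (𝓝 z) := by
  set e := chartAt (EuclideanHalfSpace (n + 1)) p.1
  have he : e ∈ IsManifold.maximalAtlas (𝓡∂ (n + 1)) ∞ N := IsManifold.chart_mem_maximalAtlas p.1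
  have hpe : p.1 ∈ e.source := mem_chart_source _ p.1
  have ha : (e p.1).1 0 = 0 := (mem_boundary_iff_of_mem_maximalAtlas he hpe).1 p.2
  have hs : Function.Surjective
      (mfderiv (𝓡 n) (𝓡 (m + 1)) (fun x : (𝓡∂ (n + 1)).boundary N => F x.1) p) := by
    by_contra h
    exact hp h
  have hFb : MDifferentiableAt (𝓡 n) (𝓡 (m + 1))
      (fun x : (𝓡∂ (n + 1)).boundary N => F x.1) p :=
    (hF.comp contMDiff_boundary_subtype_val).mdifferentiableAt (by simp)
  rw [hFb.mfderiv] at hs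
  set f := (F ∘ e.symm) ∘ (𝓡∂ (n + 1)).symm
  have hd : HasFDerivWithinAt f (fderivWithin ℝ f (range (𝓡∂ (n + 1))) (e p.1).1)
      (range (𝓡∂ (n + 1))) (e p.1).1 :=
    ((hF p.1).contDiffWithinAt_comp_chartAt_symm.differentiableWithinAt
      (by simp)).hasFDerivWithinAt
  set L := fderivWithin ℝ f (range (𝓡∂ (n + 1))) (e p.1).1
  set bc := boundaryChart e he p
  have hpb : p ∈ bc.source := hpe
  have hincl : (boundaryIncl n (bc p)).1 = (e p.1).1 :=
    congrArg Subtype.val (boundaryIncl_boundaryProj n _ ha)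
  have hi : HasFDerivAt (fun v => (boundaryIncl n v).1)
      (fderiv ℝ (fun v => (boundaryIncl n v).1) (bc p)) (bc p) :=
    ((contDiff_boundaryIncl n).differentiable (by simp) _).hasFDerivAt
  set D := fderiv ℝ (fun v => (boundaryIncl n v).1) (bc p)
  -- The restriction to the boundary has differential `L.comp D` in charts. Since `D` takes values
  -- in the hyperplane `v 0 = 0`, its surjectivity is what `isFibrewiseConnectedAt_of_boundary` asks
  -- of `L`.
  have hD0 : ∀ u, D u 0 = 0 := by
    intro u
    let pr : EuclideanSpace ℝ (Fin (n + 1)) →L[ℝ] ℝ := EuclideanSpace.proj 0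
    have h1 : HasFDerivAt (fun v => pr (boundaryIncl n v).1) (pr.comp D) (bc p) :=
      pr.hasFDerivAt.comp (bc p) hi
    have h2 : HasFDerivAt (fun v => pr (boundaryIncl n v).1)
        (0 : EuclideanSpace ℝ (Fin n) →L[ℝ] ℝ) (bc p) :=
      hasFDerivAt_const (0 : ℝ) (bc p)
    have h3 : pr.comp D = 0 := h1.unique h2
    exact DFunLike.congr_fun h3 u
  have hcomp : HasFDerivAt (f ∘ fun v => (boundaryIncl n v).1) (L.comp D) (bc p) := by
    rw [← hincl] at hd
    exact HasFDerivWithinAt.comp_hasFDerivAt (f := fun v => (boundaryIncl n v).1) (bc p) hd hi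
      (Eventually.of_forall fun v => ⟨boundaryIncl n v, rfl⟩)
  have hcongr : HasFDerivAt (fun v => F (bc.symm v).1) (L.comp D) (bc p) := by
    refine hcomp.congr_of_eventuallyEq ?_
    filter_upwards [bc.open_target.mem_nhds (bc.map_source hpb)] with v hv
    rw [coe_boundaryChart_symm_apply he p hv]
    change _ = F (e.symm ((𝓡∂ (n + 1)).symm (boundaryIncl n v).1))
    rw [show (𝓡∂ (n + 1)).symm (boundaryIncl n v).1 = boundaryIncl n v from
      (𝓡∂ (n + 1)).left_inv (boundaryIncl n v)]
  have hLD : Function.Surjective (L.comp D) := by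
    have h1 : fderivWithin ℝ (fun v => F (bc.symm v).1) (range (𝓡 n)) (bc p) = L.comp D := by
      rw [ModelWithCorners.range_eq_univ, fderivWithin_univ]
      exact hcongr.fderiv
    rw [← h1]
    exact hs
  have h := isFibrewiseConnectedAt_of_boundary (g := F ∘ e.symm) ha
    (hF p.1).contDiffWithinAt_comp_chartAt_symm (fun y => by
      obtain ⟨u, hu⟩ := hLD y
      exact ⟨D u, hD0 u, hu⟩)
  exact ⟨locallyFibreConnectedAt_of_chart e hpe h.1, eventually_nhds_le_map_of_chart e hpe h.2⟩

theorem IsBoundarySpecialGeneric.locallyFibreConnectedAt_of_notMem {h : m < n}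
    (hF : IsBoundarySpecialGeneric h F) (hp : p ∉ Subtype.val '' boundarySingularSet n F) :
    LocallyFibreConnectedAt F p ∧ ∀ᶠ z in 𝓝 p, 𝓝 (F z) ≤ map F (𝓝 z) := by
  by_cases hb : p ∈ (𝓡∂ (n + 1)).boundary N
  · exact locallyFibreConnectedAt_of_boundary ⟨p, hb⟩ hF.contMDiff fun hS => hp ⟨_, hS, rfl⟩
  · exact locallyFibreConnectedAt_of_notMem_boundary (hF.contMDiff p) (hF.submersion p) hb

end Boundary

/-- Charts `φ`, `ψ` in which `F` is the boundary definite fold normal form. -/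
structure IsFoldChartPair (h : m < n) (F : N → EuclideanSpace ℝ (Fin (m + 1)))
    (φ : OpenPartialHomeomorph N (EuclideanHalfSpace (n + 1)))
    (ψ : OpenPartialHomeomorph (EuclideanSpace ℝ (Fin (m + 1))) (EuclideanSpace ℝ (Fin (m + 1)))) :
    Prop where
  mem_source : φ ∈ IsManifold.maximalAtlas (𝓡∂ (n + 1)) ∞ N
  mem_target : ψ ∈ IsManifold.maximalAtlas (𝓡 (m + 1)) ∞ (EuclideanSpace ℝ (Fin (m + 1)))
  mapsTo : MapsTo F φ.source ψ.source
  apply_eq : ∀ x ∈ φ.source, ψ (F x) = boundaryFoldForm n m h (φ x).1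

namespace IsFoldChartPair

variable {h : m < n} {φ : OpenPartialHomeomorph N (EuclideanHalfSpace (n + 1))}
  {ψ : OpenPartialHomeomorph (EuclideanSpace ℝ (Fin (m + 1))) (EuclideanSpace ℝ (Fin (m + 1)))}

theorem apply_eq_iff (H : IsFoldChartPair h F φ ψ) {x y : N} (hx : x ∈ φ.source)
    (hy : y ∈ φ.source) :
    F x = F y ↔ boundaryFoldForm n m h (φ x).1 = boundaryFoldForm n m h (φ y).1 := by
  rw [← H.apply_eq x hx, ← H.apply_eq y hy]
  exact (ψ.injOn.eq_iff (H.mapsTo hx) (H.mapsTo hy)).symm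

/-- As `ψ` is injective on its source, `F` and the normal form have the same fibres in the chart
`φ`; the connecting sets only have to be kept inside `φ.target`. -/
theorem locallyFibreConnectedAt (H : IsFoldChartPair h F φ ψ) (hp : p ∈ φ.source) (hp0 : φ p = 0) :
    LocallyFibreConnectedAt F p := by
  refine locallyFibreConnectedAt_of_chart φ hp ?_
  intro U hU
  rw [hp0] at hU ⊢
  have hT : φ.target ∈ 𝓝 (0 : EuclideanHalfSpace (n + 1)) := by
    rw [← hp0]
    exact φ.open_target.mem_nhds (φ.map_source hp)
  have hiff : ∀ z ∈ φ.target, ∀ z' ∈ φ.target, (F ∘ φ.symm) z = (F ∘ φ.symm) z' ↔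
      boundaryFoldForm n m h z.1 = boundaryFoldForm n m h z'.1 := by
    intro z hz z' hz'
    have := H.apply_eq_iff (φ.map_target hz) (φ.map_target hz')
    rwa [φ.right_inv hz, φ.right_inv hz'] at this
  obtain ⟨O, hO, hOP⟩ := isFibrewiseConnectedAt_boundaryFoldForm h (U ∩ φ.target)
    (inter_mem hU hT)
  refine ⟨O ∩ φ.target, inter_mem hO hT, ?_⟩
  rintro z ⟨hz, hzt⟩ z' ⟨hz', hzt'⟩ hzz'
  obtain ⟨P, hP, hPU, hzP, hzP', hPf⟩ := hOP z hz z' hz' ((hiff z hzt z' hzt').1 hzz')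
  exact ⟨P, hP, fun y hy => (hPU hy).1, hzP, hzP',
    fun y hy => (hiff y (hPU hy).2 z hzt).2 (hPf y hy)⟩

theorem eq_of_apply_eq (H : IsFoldChartPair h F φ ψ) (hp : p ∈ φ.source) (hp0 : φ p = 0) {z : N}
    (hz : z ∈ φ.source) (hzp : F z = F p) : z = p := by
  have h1 := (H.apply_eq_iff hz hp).1 hzp
  have h2 : boundaryFoldForm n m h (0 : EuclideanHalfSpace (n + 1)).1 = 0 := by
    ext i
    refine Fin.cases ?_ (fun j => rfl) i
    rw [boundaryFoldForm_zero]
    change foldQuad m (0 : EuclideanSpace ℝ (Fin (n + 1))) + (0 : ℝ) = 0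
    simp [foldQuad]
  rw [hp0, h2] at h1
  have h3 := eq_zero_of_boundaryFoldForm_eq_zero h h1
  exact φ.injOn hz hp (h3.trans hp0.symm)

/-- A boundary definite fold point is a whole component of its fibre. -/
theorem fibreComponent_eq_singleton [T1Space N] (H : IsFoldChartPair h F φ ψ) (hp : p ∈ φ.source)
    (hp0 : φ p = 0) : fibreComponent F p = {p} := by
  refine Subset.antisymm ?_ (singleton_subset_iff.2 (mem_fibreComponent_self F p))
  intro z hz
  by_contra hne
  -- A component with a second point would, by connectedness, contain a point of `φ.source` other
  -- than `p`, but `p` is alone in its fibre there.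
  obtain ⟨y, hy, hyφ, hyp⟩ := (isPreconnected_connectedComponentIn :
    IsPreconnected (fibreComponent F p)) φ.source {p}ᶜ φ.open_source isOpen_compl_singleton
    (fun y hy => by
      by_cases hyp : y = p
      · exact Or.inl (hyp ▸ hp)
      · exact Or.inr hyp)
    ⟨p, mem_fibreComponent_self F p, hp⟩ ⟨z, hz, hne⟩
  exact hyp (H.eq_of_apply_eq hp hp0 hyφ (eq_of_mem_fibreComponent hy))

/-- In a fold chart, the singular set of the restriction to the boundary is a coordinate plane. -/
theorem mem_boundarySingularSet_iff [IsManifold (𝓡∂ (n + 1)) ∞ N]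
    (H : IsFoldChartPair h F φ ψ) (hF : ContMDiff (𝓡∂ (n + 1)) (𝓡 (m + 1)) ∞ F)
    (p z : (𝓡∂ (n + 1)).boundary N)
    (hz : z.1 ∈ φ.source) :
    z ∈ boundarySingularSet n F ↔
      ∀ j : Fin n, m ≤ j.val → boundaryChart φ H.mem_source p z j = 0 := by
  set bc := boundaryChart φ H.mem_source p
  have hzb : z ∈ bc.source := hz
  have hbc : bc ∈ IsManifold.maximalAtlas (𝓡 n) ∞ ((𝓡∂ (n + 1)).boundary N) :=
    IsManifold.subset_maximalAtlas ⟨φ, H.mem_source, p, rfl⟩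
  have hbcd : bc.MDifferentiable (𝓡 n) (𝓡 n) :=
    ⟨(contMDiffOn_of_mem_maximalAtlas hbc).mdifferentiableOn (by simp),
      (contMDiffOn_symm_of_mem_maximalAtlas hbc).mdifferentiableOn (by simp)⟩
  have hψd : ψ.MDifferentiable (𝓡 (m + 1)) (𝓡 (m + 1)) :=
    ⟨(contMDiffOn_of_mem_maximalAtlas H.mem_target).mdifferentiableOn (by simp),
      (contMDiffOn_symm_of_mem_maximalAtlas H.mem_target).mdifferentiableOn (by simp)⟩
  have hFb : MDifferentiableAt (𝓡 n) (𝓡 (m + 1))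
      (fun x : (𝓡∂ (n + 1)).boundary N => F x.1) z :=
    (hF.comp contMDiff_boundary_subtype_val).mdifferentiableAt (by simp)
  set G := fun v => boundaryFoldForm n m h (boundaryIncl n v).1
  have hG : MDifferentiableAt (𝓡 n) (𝓡 (m + 1)) G (bc z) :=
    (((contDiff_boundaryFoldForm h).comp (contDiff_boundaryIncl n)).differentiable
      (by simp) _).mdifferentiableAt
  have h1 := mfderiv_comp z (hψd.mdifferentiableAt (H.mapsTo hz)) hFb
  have h2 := mfderiv_comp z hG (hbcd.mdifferentiableAt hzb)
  -- In charts the restriction to the boundary is `G`; the differentials of the charts are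
  -- invertible, so surjectivity transfers.
  have heq : (ψ ∘ fun x : (𝓡∂ (n + 1)).boundary N => F x.1) =ᶠ[𝓝 z] G ∘ bc := by
    filter_upwards [bc.open_source.mem_nhds hzb] with y hy
    have hy' : y.1 ∈ φ.source := hy
    have h0 := (mem_boundary_iff_of_mem_maximalAtlas H.mem_source hy').1 y.2
    change ψ (F y.1) = boundaryFoldForm n m h (boundaryIncl n (boundaryProj n (φ y.1).1)).1
    rw [boundaryIncl_boundaryProj n _ h0, H.apply_eq _ hy']
  rw [heq.mfderiv_eq, h2] at h1
  have hψb := hψd.mfderiv_bijective (H.mapsTo hz)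
  have hbb := hbcd.mfderiv_surjective hzb
  have hsurj : Function.Surjective
      (mfderiv (𝓡 n) (𝓡 (m + 1)) (fun x : (𝓡∂ (n + 1)).boundary N => F x.1) z) ↔
      Function.Surjective (mfderiv (𝓡 n) (𝓡 (m + 1)) G (bc z)) := by
    have h3 : ∀ u : EuclideanSpace ℝ (Fin n),
        (mfderiv (𝓡 n) (𝓡 (m + 1)) G (bc z) (mfderiv (𝓡 n) (𝓡 n) bc z u) :
          EuclideanSpace ℝ (Fin (m + 1))) =
        mfderiv (𝓡 (m + 1)) (𝓡 (m + 1)) ψ (F z.1)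
          (mfderiv (𝓡 n) (𝓡 (m + 1)) (fun x : (𝓡∂ (n + 1)).boundary N => F x.1) z u) :=
      fun u => DFunLike.congr_fun h1 u
    constructor
    · intro hs y
      obtain ⟨y', rfl⟩ := hψb.2 y
      obtain ⟨u, rfl⟩ := hs y'
      exact ⟨_, h3 u⟩
    · intro hs y
      obtain ⟨v, hv⟩ := hs (mfderiv (𝓡 (m + 1)) (𝓡 (m + 1)) ψ (F z.1) y)
      obtain ⟨u, rfl⟩ := hbb v
      exact ⟨u, hψb.1 ((h3 u).symm.trans hv)⟩
  have hfold : Function.Surjective (mfderiv (𝓡 n) (𝓡 (m + 1)) G (bc z)) ↔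
      ∃ j : Fin n, m ≤ j.val ∧ bc z j ≠ 0 := by
    rw [mfderiv_eq_fderiv]
    exact surjective_fderiv_boundaryFoldForm_boundaryIncl h (bc z)
  refine (not_congr (hsurj.trans hfold)).trans ?_
  push Not
  rfl

end IsFoldChartPair

end LocalStructure

/-! ### The smooth structure of the Reeb space -/

section ReebManifold

open Set Filter Topology

/-- Translations serve as target charts that move the image of an interior chart into the
half-space. -/
theorem addRight_toOpenPartialHomeomorph_mem_maximalAtlas {E : Type*} [NormedAddCommGroup E]
    [NormedSpace ℝ E] (t : E) :
    (Homeomorph.addRight t).toOpenPartialHomeomorph ∈ IsManifold.maximalAtlas 𝓘(ℝ, E) ∞ E := by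
  refine StructureGroupoid.mem_maximalAtlas_of_mem_groupoid _ ?_
  rw [contDiffGroupoid, mem_groupoid_of_pregroupoid]
  constructor
  · change ContDiffOn ℝ ∞ (fun x => x + t) _
    exact (contDiff_id.add contDiff_const).contDiffOn
  · change ContDiffOn ℝ ∞ (fun x => x + -t) _
    exact (contDiff_id.add contDiff_const).contDiffOn

/-- A bijection which is the identity in suitable charts is a diffeomorphism. -/
theorem Equiv.contMDiff_and_contMDiff_symm_of_charts {E : Type*} [NormedAddCommGroup E]
    [NormedSpace ℝ E] {A B : Type*} [TopologicalSpace A] [ChartedSpace E A]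
    [TopologicalSpace B] [ChartedSpace E B] (Φ : A ≃ B) (hΦ : Continuous Φ)
    (h : ∀ p, ∃ a ∈ IsManifold.maximalAtlas 𝓘(ℝ, E) ∞ A,
      ∃ b ∈ IsManifold.maximalAtlas 𝓘(ℝ, E) ∞ B, Φ p ∈ b.source ∧
        ∀ z, Φ z ∈ b.source → z ∈ a.source ∧ a z = b (Φ z)) :
    ContMDiff 𝓘(ℝ, E) 𝓘(ℝ, E) ∞ Φ ∧ ContMDiff 𝓘(ℝ, E) 𝓘(ℝ, E) ∞ Φ.symm := by
  constructor
  · intro p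
    obtain ⟨a, ha, b, hb, hp, hz⟩ := h p
    have hpa := hz p hp
    have h1 : ContMDiffAt 𝓘(ℝ, E) 𝓘(ℝ, E) ∞ a p := contMDiffAt_of_mem_maximalAtlas ha hpa.1
    have h2 : ContMDiffAt 𝓘(ℝ, E) 𝓘(ℝ, E) ∞ b.symm (a p) := by
      rw [hpa.2]
      exact contMDiffAt_symm_of_mem_maximalAtlas hb (b.map_source hp)
    refine (h2.comp p h1).congr_of_eventuallyEq ?_
    filter_upwards [(b.open_source.preimage hΦ).mem_nhds hp] with z hzb
    rw [Function.comp_apply, (hz z hzb).2, b.left_inv hzb]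
  · intro q
    obtain ⟨p, rfl⟩ := Φ.surjective q
    obtain ⟨a, ha, b, hb, hp, hz⟩ := h p
    have hpa := hz p hp
    have h1 : ContMDiffAt 𝓘(ℝ, E) 𝓘(ℝ, E) ∞ b (Φ p) := contMDiffAt_of_mem_maximalAtlas hb hp
    have h2 : ContMDiffAt 𝓘(ℝ, E) 𝓘(ℝ, E) ∞ a.symm (b (Φ p)) := by
      rw [← hpa.2]
      exact contMDiffAt_symm_of_mem_maximalAtlas ha (a.map_source hpa.1)
    refine (h2.comp (Φ p) h1).congr_of_eventuallyEq ?_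
    filter_upwards [b.open_source.mem_nhds hp] with w hw
    obtain ⟨z, rfl⟩ := Φ.surjective w
    rw [Function.comp_apply, ← (hz z hw).2, a.left_inv (hz z hw).1, Φ.symm_apply_apply]

/-! ### Charts of the Reeb space -/

section ChartData

variable {k : ℕ} {X : Type*} [TopologicalSpace X] {F : X → EuclideanSpace ℝ (Fin (k + 1))}

/-- A chart of the Reeb space obtained from a saturated open set on which the Reeb map is
injective and, followed by a chart of `ℝ^(k+1)`, open into the half-space. -/
def HalfSpaceChartData.ofReebSaturated (hF : Continuous F) {V : Set X} (hV : IsOpen V)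
    (hVs : IsReebSaturated F V)
    (ψ : OpenPartialHomeomorph (EuclideanSpace ℝ (Fin (k + 1))) (EuclideanSpace ℝ (Fin (k + 1))))
    (hψ : ψ ∈ IsManifold.maximalAtlas (𝓡 (k + 1)) ∞ (EuclideanSpace ℝ (Fin (k + 1))))
    (hinj : ∀ z ∈ V, ∀ z' ∈ V, F z = F z' → reebQuot F z = reebQuot F z')
    (hmaps : MapsTo F V ψ.source) (hnonneg : ∀ z ∈ V, 0 ≤ ψ (F z) 0)
    (hopen : ∀ z ∈ V, 𝓝 ((𝓡∂ (k + 1)).symm (ψ (F z))) ≤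
      map (fun z => (𝓡∂ (k + 1)).symm (ψ (F z))) (𝓝 z)) : HalfSpaceChartData (reebMap F) where
  source := reebQuot F '' V
  ψ := ψ
  open_source := hVs.isOpen_image hV
  mem_maximalAtlas := hψ
  continuousOn := (continuous_reebMap hF).continuousOn
  injOn := by
    rintro _ ⟨z, hz, rfl⟩ _ ⟨z', hz', rfl⟩ h
    exact hinj z hz z' hz' h
  mapsTo := by
    rintro _ ⟨z, hz, rfl⟩
    exact hmaps hz
  nonneg := by
    rintro _ ⟨z, hz, rfl⟩
    exact hnonneg z hz
  isOpen_image := by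
    intro O hO hOo
    rw [isOpen_iff_mem_nhds]
    rintro _ ⟨w, hw, rfl⟩
    obtain ⟨z, hz, rfl⟩ := hO hw
    refine mem_of_superset (hopen z hz (image_mem_map
      ((hOo.preimage (continuous_reebQuot F)).mem_nhds hw))) ?_
    rintro _ ⟨z', hz', rfl⟩
    exact ⟨reebQuot F z', hz', rfl⟩

/-- The Reeb space has an interior chart at a fibre component near which `F` is open and locally
fibre connected. -/
theorem exists_halfSpaceChartData_of_isOpenAt [CompactSpace X] [T2Space X] (hF : Continuous F)
    {p : X} (h : ∀ z ∈ fibreComponent F p, LocallyFibreConnectedAt F z ∧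
      ∀ᶠ z' in 𝓝 z, 𝓝 (F z') ≤ map F (𝓝 z')) :
    ∃ d : HalfSpaceChartData (reebMap F), reebQuot F p ∈ d.source ∧ 0 < d.ψ (F p) 0 := by
  obtain ⟨A, hA, hpA, hAinj⟩ := exists_isOpen_reebQuot_eq_of_isOpenAt hF p
    (fun z hz => (h z hz).1) (fun z hz => (h z hz).2.self_of_nhds)
  -- Translation by `t` below puts `F p` at height `1`, and `B` keeps the rest of the chart at
  -- positive height, away from the boundary of the half-space.
  set B : Set X := {z | F p 0 - 1 < F z 0}
  have hB : IsOpen B := isOpen_lt continuous_const ((PiLp.continuous_apply 2 _ 0).comp hF)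
  obtain ⟨V, hV, hpV, hVA, hVs⟩ := exists_isOpen_isReebSaturated hF p
    ((hA.inter (isOpen_interior (s := {z | 𝓝 (F z) ≤ map F (𝓝 z)}))).inter hB) (by
      intro z hz
      refine ⟨⟨hpA hz, mem_interior_iff_mem_nhds.2 (h z hz).2⟩, ?_⟩
      change F p 0 - 1 < F z 0
      rw [eq_of_mem_fibreComponent hz]
      linarith)
  set t : EuclideanSpace ℝ (Fin (k + 1)) := EuclideanSpace.single 0 (1 - F p 0)
  have hpos : ∀ z ∈ V, 0 < (F z + t) 0 := by
    intro z hz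
    have h1 : F p 0 - 1 < F z 0 := (hVA hz).2
    have h2 : (F z + t) 0 = F z 0 + (1 - F p 0) := by simp [t]
    rw [h2]
    linarith
  refine ⟨.ofReebSaturated hF hV hVs (Homeomorph.addRight t).toOpenPartialHomeomorph
    (addRight_toOpenPartialHomeomorph_mem_maximalAtlas t)
    (fun z hz z' hz' => hAinj z (hVA hz).1.1 z' (hVA hz').1.1) (fun _ _ => trivial)
    (fun z hz => (hpos z hz).le) ?_, ⟨p, hpV, rfl⟩, hpos p hpV⟩
  intro z hz
  have h1 : 𝓝 (F z) ≤ map F (𝓝 z) := interior_subset (hVA hz).1.2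
  change 𝓝 ((𝓡∂ (k + 1)).symm (F z + t)) ≤
    map ((𝓡∂ (k + 1)).symm ∘ (Homeomorph.addRight t) ∘ F) (𝓝 z)
  rw [← map_map, ← map_map]
  refine le_trans ?_ (map_mono (map_mono h1))
  rw [(Homeomorph.addRight t).map_nhds_eq]
  have h2 := (𝓡∂ (k + 1)).symm_map_nhdsWithin_range ((𝓡∂ (k + 1)).symm (F z + t))
  rw [(𝓡∂ (k + 1)).right_inv (by
    rw [range_modelWithCornersEuclideanHalfSpace]; exact (hpos z hz).le)] at h2
  rw [← h2]
  exact map_mono nhdsWithin_le_nhds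

end ChartData

variable {n m : ℕ} {N : Type*} [TopologicalSpace N] [ChartedSpace (EuclideanHalfSpace (n + 1)) N]
  {F : N → EuclideanSpace ℝ (Fin (m + 1))} {h : m < n} {p : N}

/-- The Reeb space has a boundary chart at a boundary definite fold point. -/
theorem IsFoldChartPair.exists_halfSpaceChartData [CompactSpace N] [T2Space N]
    {φ : OpenPartialHomeomorph N (EuclideanHalfSpace (n + 1))}
    {ψ : OpenPartialHomeomorph (EuclideanSpace ℝ (Fin (m + 1))) (EuclideanSpace ℝ (Fin (m + 1)))}
    (H : IsFoldChartPair h F φ ψ) (hF : Continuous F) (hp : p ∈ φ.source) (hp0 : φ p = 0) :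
    ∃ d : HalfSpaceChartData (reebMap F), reebQuot F p ∈ d.source ∧ d.ψ = ψ ∧
      ∀ x, reebQuot F x ∈ d.source → x ∈ φ.source := by
  obtain ⟨O, hO, hOinj⟩ := H.locallyFibreConnectedAt hp hp0
  -- The fibre component is `{p}`, so local fibre connectedness at `p` alone gives injectivity on a
  -- saturated neighbourhood.
  obtain ⟨V, hV, hpV, hVA, hVs⟩ := exists_isOpen_isReebSaturated hF p
    (isOpen_interior.inter φ.open_source : IsOpen (interior O ∩ φ.source)) (by
      rw [H.fibreComponent_eq_singleton hp hp0, singleton_subset_iff]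
      exact ⟨mem_interior_iff_mem_nhds.2 hO, hp⟩)
  have heq : ∀ z ∈ φ.source, (𝓡∂ (m + 1)).symm (ψ (F z)) = halfSpaceFold n m h (φ z) := by
    intro z hz
    rw [H.apply_eq z hz]
    exact (𝓡∂ (m + 1)).left_inv (halfSpaceFold n m h (φ z))
  refine ⟨.ofReebSaturated hF hV hVs ψ H.mem_target
    (fun z hz z' hz' => hOinj z (interior_subset (hVA hz).1) z' (interior_subset (hVA hz').1))
    (fun z hz => H.mapsTo (hVA hz).2) (fun z hz => ?_) (fun z hz => ?_), ⟨p, hpV, rfl⟩, rfl, ?_⟩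
  · rw [H.apply_eq z (hVA hz).2]
    exact (halfSpaceFold n m h (φ z)).2
  · have hz' := (hVA hz).2
    have hev : (fun z => (𝓡∂ (m + 1)).symm (ψ (F z))) =ᶠ[𝓝 z] halfSpaceFold n m h ∘ φ :=
      eventually_of_mem (φ.open_source.mem_nhds hz') heq
    rw [map_congr hev, ← map_map, φ.map_nhds_eq hz', heq z hz']
    exact nhds_le_map_halfSpaceFold h (φ z)
  · intro x hx
    have hx' : x ∈ reebQuot F ⁻¹' (reebQuot F '' V) := hx
    rw [hVs.preimage_image] at hx'
    exact (hVA hx').2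

/-- The inclusion of the first `m` coordinates. -/
def coordIncl (n m : ℕ) : EuclideanSpace ℝ (Fin m) →L[ℝ] EuclideanSpace ℝ (Fin n) :=
  LinearMap.toContinuousLinearMap
    { toFun v := WithLp.toLp 2 fun j => if hj : j.val < m then v ⟨j.val, hj⟩ else 0
      map_add' v w := by
        ext j
        by_cases hj : j.val < m <;> simp [hj]
      map_smul' c v := by
        ext j
        by_cases hj : j.val < m <;> simp [hj] }

/-- The projection to the first `m` coordinates. -/
def coordProj (h : m < n) : EuclideanSpace ℝ (Fin n) →L[ℝ] EuclideanSpace ℝ (Fin m) :=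
  LinearMap.toContinuousLinearMap
    { toFun x := WithLp.toLp 2 fun i => x (Fin.castLE h.le i)
      map_add' _ _ := rfl
      map_smul' _ _ := rfl }

theorem coordIncl_apply (v : EuclideanSpace ℝ (Fin m)) (j : Fin n) :
    coordIncl n m v j = if hj : j.val < m then v ⟨j.val, hj⟩ else 0 := rfl

theorem coordProj_apply (h : m < n) (x : EuclideanSpace ℝ (Fin n)) (i : Fin m) :
    coordProj h x i = x (Fin.castLE h.le i) := rfl

theorem coordProj_coordIncl (h : m < n) (v : EuclideanSpace ℝ (Fin m)) :
    coordProj h (coordIncl n m v) = v := by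
  ext i
  simp [coordProj_apply, coordIncl_apply]

theorem coordIncl_coordProj_eq_iff (h : m < n) (x : EuclideanSpace ℝ (Fin n)) :
    coordIncl n m (coordProj h x) = x ↔ ∀ j : Fin n, m ≤ j.val → x j = 0 := by
  constructor
  · intro hx j hj
    rw [← hx, coordIncl_apply, dif_neg (not_lt.2 hj)]
  · intro hx
    ext j
    rw [coordIncl_apply]
    split_ifs with hj
    · rfl
    · exact (hx j (not_lt.1 hj)).symm

variable [IsManifold (𝓡∂ (n + 1)) ∞ N]

/-- In boundary coordinates the singular set and the range of `coordIncl` are both the locus where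
the coordinates of index at least `m` vanish. -/
theorem IsFoldChartPair.isSliceChart {φ : OpenPartialHomeomorph N (EuclideanHalfSpace (n + 1))}
    {ψ : OpenPartialHomeomorph (EuclideanSpace ℝ (Fin (m + 1))) (EuclideanSpace ℝ (Fin (m + 1)))}
    (H : IsFoldChartPair h F φ ψ) (hF : ContMDiff (𝓡∂ (n + 1)) (𝓡 (m + 1)) ∞ F)
    (p : (𝓡∂ (n + 1)).boundary N) :
    IsSliceChart (boundarySingularSet n F) (coordIncl n m) (coordProj h)
      (boundaryChart φ H.mem_source p) := fun z hz => by
  rw [H.mem_boundarySingularSet_iff hF p z hz, coordIncl_coordProj_eq_iff]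

theorem IsBoundarySpecialGeneric.exists_isFoldChartPair (hF : IsBoundarySpecialGeneric h F)
    {p : (𝓡∂ (n + 1)).boundary N} (hp : p ∈ boundarySingularSet n F) :
    ∃ φ ψ, IsFoldChartPair h F φ ψ ∧ p.1 ∈ φ.source ∧ φ p.1 = 0 := by
  obtain ⟨φ, hφ, ψ, hψ, hpφ, hp0, hmaps, heq⟩ := hF.fold p hp
  exact ⟨φ, ψ, ⟨hφ, hψ, hmaps, heq⟩, hpφ, hp0⟩

theorem IsBoundarySpecialGeneric.exists_slice (hF : IsBoundarySpecialGeneric h F)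
    (p : boundarySingularSet n F) :
    ∃ c ∈ IsManifold.maximalAtlas (𝓡 n) ∞ ((𝓡∂ (n + 1)).boundary N),
      IsSliceChart (boundarySingularSet n F) (coordIncl n m) (coordProj h) c ∧ p.1 ∈ c.source := by
  obtain ⟨φ, ψ, H, hp, -⟩ := hF.exists_isFoldChartPair p.2
  exact ⟨boundaryChart φ H.mem_source p.1,
    IsManifold.subset_maximalAtlas ⟨φ, H.mem_source, p.1, rfl⟩,
    H.isSliceChart hF.contMDiff p.1, hp⟩

theorem IsBoundarySpecialGeneric.fibreComponent_eq_singleton [T1Space N]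
    (hF : IsBoundarySpecialGeneric h F)
    {p : (𝓡∂ (n + 1)).boundary N} (hp : p ∈ boundarySingularSet n F) :
    fibreComponent F p.1 = {p.1} := by
  obtain ⟨φ, ψ, H, hpφ, hp0⟩ := hF.exists_isFoldChartPair hp
  exact H.fibreComponent_eq_singleton hpφ hp0

variable [CompactSpace N] [T2Space N]

/-- The hypothesis makes the whole fibre component of `p` avoid the singular set, so `F` is open and
locally fibre connected at all of its points. -/
theorem IsBoundarySpecialGeneric.exists_halfSpaceChartData_of_notMem
    (hF : IsBoundarySpecialGeneric h F)
    (hp : reebQuot F p ∉ (fun s => reebQuot F s.1) '' boundarySingularSet n F) :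
    ∃ d : HalfSpaceChartData (reebMap F), reebQuot F p ∈ d.source ∧ 0 < d.ψ (F p) 0 := by
  refine exists_halfSpaceChartData_of_isOpenAt hF.contMDiff.continuous fun z hz => ?_
  refine hF.locallyFibreConnectedAt_of_notMem ?_
  rintro ⟨s, hs, rfl⟩
  exact hp ⟨s, hs, (reebQuot_eq_iff.2 hz).symm⟩

theorem IsBoundarySpecialGeneric.exists_halfSpaceChartData (hF : IsBoundarySpecialGeneric h F)
    (w : ReebSpace F) : ∃ d : HalfSpaceChartData (reebMap F), w ∈ d.source := by
  by_cases hw : w ∈ (fun s => reebQuot F s.1) '' boundarySingularSet n F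
  · obtain ⟨s, hs, rfl⟩ := hw
    obtain ⟨φ, ψ, H, hpφ, hp0⟩ := hF.exists_isFoldChartPair hs
    obtain ⟨d, hd, -⟩ := H.exists_halfSpaceChartData hF.contMDiff.continuous hpφ hp0
    exact ⟨d, hd⟩
  · obtain ⟨p, rfl⟩ := reebQuot_surjective F w
    obtain ⟨d, hd, -⟩ := hF.exists_halfSpaceChartData_of_notMem hw
    exact ⟨d, hd⟩

variable [Nonempty N]

instance : Nonempty (ReebSpace F) := ‹Nonempty N›.map (reebQuot F)

/-- The boundary of the Reeb space is the image of the singular set. -/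
theorem IsBoundarySpecialGeneric.boundary_reebSpace (hF : IsBoundarySpecialGeneric h F) :
    letI := HalfSpaceChartData.chartedSpace hF.exists_halfSpaceChartData
    (𝓡∂ (m + 1)).boundary (ReebSpace F) =
      (fun s => reebQuot F s.1) '' boundarySingularSet n F := by
  let _ := HalfSpaceChartData.chartedSpace hF.exists_halfSpaceChartData
  have := HalfSpaceChartData.isManifold hF.exists_halfSpaceChartData
  have key : ∀ (d : HalfSpaceChartData (reebMap F)) (w), w ∈ d.source →
      (w ∈ (𝓡∂ (m + 1)).boundary (ReebSpace F) ↔ d.ψ (reebMap F w) 0 = 0) := by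
    intro d w hw
    rw [mem_boundary_iff_of_mem_maximalAtlas
      (HalfSpaceChartData.chart_mem_maximalAtlas hF.exists_halfSpaceChartData d) hw,
      d.coe_chart_apply hw]
  ext w
  constructor
  · intro hw
    by_contra hwS
    obtain ⟨p, rfl⟩ := reebQuot_surjective F w
    obtain ⟨d, hd, hpos⟩ := hF.exists_halfSpaceChartData_of_notMem hwS
    exact hpos.ne' ((key d _ hd).1 hw)
  · rintro ⟨s, hs, rfl⟩
    obtain ⟨φ, ψ, H, hpφ, hp0⟩ := hF.exists_isFoldChartPair hs
    obtain ⟨d, hd, rfl, -⟩ := H.exists_halfSpaceChartData hF.contMDiff.continuous hpφ hp0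
    refine (key d _ hd).2 ?_
    rw [reebMap_reebQuot, H.apply_eq _ hpφ, boundaryFoldForm_zero, hp0]
    change foldQuad m (0 : EuclideanSpace ℝ (Fin (n + 1))) + (0 : ℝ) = 0
    simp [foldQuad]

/-- The quotient map restricts to a diffeomorphism from the singular set to the boundary of the
Reeb space. -/
theorem IsBoundarySpecialGeneric.exists_diffeomorph (hF : IsBoundarySpecialGeneric h F) :
    letI := HalfSpaceChartData.chartedSpace hF.exists_halfSpaceChartData
    letI := HalfSpaceChartData.isManifold hF.exists_halfSpaceChartData
    letI := sliceChartedSpace (coordProj_coordIncl h) hF.exists_slice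
    ∃ Φ : Diffeomorph (𝓡 m) (𝓡 m) (boundarySingularSet n F)
      ((𝓡∂ (m + 1)).boundary (ReebSpace F)) ∞,
      ∀ p : boundarySingularSet n F, (Φ p).1 = reebQuot F p.1.1 := by
  let _ := HalfSpaceChartData.chartedSpace hF.exists_halfSpaceChartData
  have hW := HalfSpaceChartData.isManifold hF.exists_halfSpaceChartData
  let _ := sliceChartedSpace (coordProj_coordIncl h) hF.exists_slice
  let f : boundarySingularSet n F → (𝓡∂ (m + 1)).boundary (ReebSpace F) := fun p =>
    ⟨reebQuot F p.1.1, by rw [hF.boundary_reebSpace]; exact ⟨p.1, p.2, rfl⟩⟩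
  have hf : Continuous f := Continuous.subtype_mk
    ((continuous_reebQuot F).comp (continuous_subtype_val.comp continuous_subtype_val)) _
  have hbij : Function.Bijective f := by
    constructor
    · intro p p' hpp
      -- Injectivity: a singular point is alone in its Reeb class.
      have h1 : p'.1.1 ∈ fibreComponent F p.1.1 := reebQuot_eq_iff.1 (congrArg Subtype.val hpp)
      rw [hF.fibreComponent_eq_singleton p.2] at h1
      exact (Subtype.ext (Subtype.ext h1)).symm
    · rintro ⟨w, hw⟩
      rw [hF.boundary_reebSpace] at hw
      obtain ⟨s, hs, rfl⟩ := hw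
      exact ⟨⟨s, hs⟩, rfl⟩
  have hΦ := (Equiv.ofBijective f hbij).contMDiff_and_contMDiff_symm_of_charts hf (by
    intro p
    obtain ⟨φ, ψ, H, hpφ, hp0⟩ := hF.exists_isFoldChartPair p.2
    obtain ⟨d, hd, hdψ, hdφ⟩ := H.exists_halfSpaceChartData hF.contMDiff.continuous hpφ hp0
    have hdm := HalfSpaceChartData.chart_mem_maximalAtlas hF.exists_halfSpaceChartData d
    have hbm : boundaryChart d.chart hdm (f p) ∈
        IsManifold.maximalAtlas (𝓡 m) ∞ ((𝓡∂ (m + 1)).boundary (ReebSpace F)) :=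
      IsManifold.subset_maximalAtlas ⟨d.chart, hdm, f p, rfl⟩
    refine ⟨sliceChart (coordProj_coordIncl h) (boundaryChart φ H.mem_source p.1)
      (H.isSliceChart hF.contMDiff p.1) p,
      sliceChart_mem_maximalAtlas (coordProj_coordIncl h) hF.exists_slice
        (IsManifold.subset_maximalAtlas ⟨φ, H.mem_source, p.1, rfl⟩) _ p,
      boundaryChart d.chart hdm (f p), hbm, hd, fun z hz => ?_⟩
    have hz' : reebQuot F z.1.1 ∈ d.source := hz
    have hzφ := hdφ _ hz'
    refine ⟨hzφ, ?_⟩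
    -- Both sides are coordinates `1, …, m` of `φ z`, which the normal form leaves unchanged.
    change coordProj h (boundaryProj n (φ z.1.1).1) =
      boundaryProj m (d.chart (reebQuot F z.1.1)).1
    rw [d.coe_chart_apply hz', hdψ, reebMap_reebQuot, H.apply_eq _ hzφ]
    rfl)
  exact ⟨⟨Equiv.ofBijective f hbij, hΦ.1, hΦ.2⟩, fun p => rfl⟩

end ReebManifold

end

theorem proposition2p5 {n m : ℕ} (hmn : m < n) {N : Type*} [TopologicalSpace N]
    [ChartedSpace (EuclideanHalfSpace (n + 1)) N] [IsManifold (𝓡∂ (n + 1)) ∞ N]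
    [T2Space N] [CompactSpace N] [ConnectedSpace N]
    (F : N → EuclideanSpace ℝ (Fin (m + 1))) (hF : IsBoundarySpecialGeneric hmn F) :
    T2Space (ReebSpace F) ∧ SecondCountableTopology (ReebSpace F) ∧
    ∃ (_ : ChartedSpace (EuclideanHalfSpace (m + 1)) (ReebSpace F))
      (_ : IsManifold (𝓡∂ (m + 1)) ∞ (ReebSpace F)),
      Manifold.IsImmersion (𝓡∂ (m + 1)) (𝓡 (m + 1)) ∞ (reebMap F) ∧
      ContMDiff (𝓡∂ (n + 1)) (𝓡∂ (m + 1)) ∞ (reebQuot F) ∧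
      ∃ (_ : ChartedSpace (EuclideanSpace ℝ (Fin m)) (boundarySingularSet n F))
        (_ : IsManifold (𝓡 m) ∞ (boundarySingularSet n F)),
        Manifold.IsSmoothEmbedding (𝓡 m) (𝓡 n) ∞
          (Subtype.val : boundarySingularSet n F → (𝓡∂ (n + 1)).boundary N) ∧
        ∃ Φ : Diffeomorph (𝓡 m) (𝓡 m) (boundarySingularSet n F)
            ((𝓡∂ (m + 1)).boundary (ReebSpace F)) ∞,
          ∀ p : boundarySingularSet n F, (Φ p).1 = reebQuot F p.1.1 := by
  have hW := hF.exists_halfSpaceChartData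
  let cW := HalfSpaceChartData.chartedSpace hW
  have hM := HalfSpaceChartData.isManifold hW
  have himm := HalfSpaceChartData.isImmersion hW
  have hsc : SecondCountableTopology (ReebSpace F) := by
    have : SecondCountableTopology (EuclideanHalfSpace (m + 1)) :=
      TopologicalSpace.Subtype.secondCountableTopology _
    -- The Reeb space is compact as a quotient of `N`, hence σ-compact.
    exact ChartedSpace.secondCountable_of_sigmaCompact (EuclideanHalfSpace (m + 1)) (ReebSpace F)
  refine ⟨t2Space_reebSpace hF.contMDiff.continuous, hsc, cW, hM, himm, ?_,
    sliceChartedSpace (coordProj_coordIncl hmn) hF.exists_slice,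
    sliceIsManifold (coordProj_coordIncl hmn) hF.exists_slice,
    sliceIsSmoothEmbedding (coordProj_coordIncl hmn) hF.exists_slice, hF.exists_diffeomorph⟩
  -- The composite `reebMap F ∘ reebQuot F` is `F`, and a continuous map is smooth once its
  -- composite with an immersion is.
  exact (ContMDiff.iff_comp_isImmersion himm).2 ⟨continuous_reebQuot F, hF.contMDiff⟩
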